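/- Let $\mathbb K$ be a field of characteristic zero and $g,n\ge 0$ integers. For a finite set $I$ let $\mathfrak t^f_{g,I}$ be the Lie algebra over $\mathbb K$ generated by $t_{ij}$ $(i,j\in I)$ and $x_i^a,y_i^a$ $(i\in I,\ 1\le a\le g)$ with the relations, for $i,j,k,l\in I$ and $1\le a,b\le g$: $t_{ij}=t_{ji}$; $[t_{ij},t_{kl}]=0$ if $\{i,j\}\cap\{k,l\}=\varnothing$; $[t_{ij},t_{ik}+t_{jk}]=0$ if $k\notin\{i,j\}$; $[x_i^a,y_j^b]=\delta_{ab}t_{ij}$ and $[x_i^a,x_j^b]=[y_i^a,y_j^b]=0$ if $i\ne j$; $[x_k^a,t_{ij}]=[y_k^a,t_{ij}]=0$ if $k\notin\{i,j\}$; $[x_i^a+x_j^a,t_{ij}]=[y_i^a+y_j^a,t_{ij}]=0$; and $\sum_{a}[x_i^a,y_i^a]+\sum_{j\in I\setminus\{i\}}t_{ij}=(g-1)t_{ii}$. Write $\mathfrak t^f_{g,12\cdots n0}$ and $\mathfrak t^f_{g,12\cdots n*0}$ for $I=\{1,\dots,n,0\}$ and $I=\{1,\dots,n,*,0\}$. Let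 $\varepsilon^*\colon\mathfrak t^f_{g,12\cdots n*0}\to\mathfrak t^f_{g,12\cdots n0}$ be the Lie homomorphism sending every generator having $*$ among its subscripts to $0$ and every other generator to itself, and let $\circ_0\mathrm{id}_{*0}\colon\mathfrak t^f_{g,12\cdots n0}\to\mathfrak t^f_{g,12\cdots n*0}$ be the Lie homomorphism replacing each subscript $0$ by the set $\{*,0\}$ and expanding additively, i.e. for $1\le i,j\le n$: $t_{ij}\mapsto t_{ij}$, $t_{i0}\mapsto t_{i*}+t_{i0}$, $t_{00}\mapsto t_{**}+2t_{*0}+t_{00}$, $x_i^a\mapsto x_i^a$, $y_i^a\mapsto y_i^a$, $x_0^a\mapsto x_*^a+x_0^a$, $y_0^a\mapsto y_*^a+y_0^a$. Let $H$ be the vector space with basis $t_{i*},x_*^a,y_*^a$ $(1\le i\le n,\ 1\le a\le g)$, let $\mathfrak u^f_{g,12\cdots n}=L(H)\oplus\mathbb K t_{**}$ be the direct sum of the free Lie algebra on $H$ and a one-dimensional abelian Lie algebra, let $\iota\colon\mathfrak u^f_{g,12\cdots n}\to\mathfrak t^f_{g,12\cdots n*0}$ be the natural homomorphism, and put $\omega_*=\sum_a[x_*^a,y_*^a]+\sum_{1\le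 j\le n}t_{j*}-(g-1)t_{**}\in\mathfrak u^f_{g,12\cdots n}$. (1) The sequence of Lie algebras $$0\to\mathfrak u^f_{g,12\cdots n}\xrightarrow{\ \iota\ }\mathfrak t^f_{g,12\cdots n*0}\xrightarrow{\ \varepsilon^*\ }\mathfrak t^f_{g,12\cdots n0}\to 0$$ is exact, and it is split by the Lie homomorphism $\circ_0\mathrm{id}_{*0}$, that is, $\varepsilon^*\circ(\circ_0\mathrm{id}_{*0})=\mathrm{id}$. (2) There is an action of $\mathfrak t^f_{g,12\cdots n0}$ on $\mathfrak u^f_{g,12\cdots n}$ by derivations with the following values, where $1\le i,j,k\le n$ and $1\le a,b\le g$. Every generator acts by $0$ on $t_{**}$, and $$\begin{aligned} t_{ij}\cdot t_{k*}&=[t_{k*},\delta_{ik}t_{j*}+\delta_{jk}t_{i*}], & t_{ij}\cdot x_*^b&=0, & t_{ij}\cdot y_*^b&=0,\\ t_{i0}\cdot t_{k*}&=[t_{i*}+\delta_{ik}\omega_*,t_{k*}], & t_{i0}\cdot x_*^b&=[t_{i*},x_*^b], & t_{i0}\cdot y_*^b&=[t_{i*},y_*^b],\\ t_{00}\cdot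 t_{k*}&=2[t_{k*},\omega_*], & t_{00}\cdot x_*^b&=2[x_*^b,\omega_*], & t_{00}\cdot y_*^b&=2[y_*^b,\omega_*],\\ x_i^a\cdot t_{k*}&=\delta_{ik}[t_{k*},x_*^a], & x_i^a\cdot x_*^b&=0, & x_i^a\cdot y_*^b&=\delta_{ab}t_{i*},\\ x_0^a\cdot t_{k*}&=[x_*^a,t_{k*}], & x_0^a\cdot x_*^b&=[x_*^a,x_*^b], & x_0^a\cdot y_*^b&=[x_*^a,y_*^b]-\delta_{ab}\omega_*,\\ y_i^a\cdot t_{k*}&=\delta_{ik}[t_{k*},y_*^a], & y_i^a\cdot x_*^b&=-\delta_{ab}t_{i*}, & y_i^a\cdot y_*^b&=0,\\ y_0^a\cdot t_{k*}&=[y_*^a,t_{k*}], & y_0^a\cdot x_*^b&=[y_*^a,x_*^b]+\delta_{ab}\omega_*, & y_0^a\cdot y_*^b&=[y_*^a,y_*^b]. \end{aligned}$$ For the semidirect product formed with this action, the map $F=\iota+\circ_0\mathrm{id}_{*0}\colon\mathfrak u^f_{g,12\cdots n}\rtimes\mathfrak t^f_{g,12\cdots n0}\to\mathfrak t^f_{g,12\cdots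 n*0}$ is a Lie homomorphism, and there is a Lie homomorphism $G\colon\mathfrak t^f_{g,12\cdots n*0}\to\mathfrak u^f_{g,12\cdots n}\rtimes\mathfrak t^f_{g,12\cdots n0}$ with $$\begin{aligned} &G(t_{ij})=(0,t_{ij}),\quad G(t_{i*})=(t_{i*},0),\quad G(t_{i0})=(-t_{i*},t_{i0}),\\ &G(t_{**})=(t_{**},0),\quad G(t_{*0})=(-\omega_*,0),\quad G(t_{00})=(-t_{**}+2\omega_*,t_{00}),\\ &G(x_i^a)=(0,x_i^a),\quad G(x_*^a)=(x_*^a,0),\quad G(x_0^a)=(-x_*^a,x_0^a),\\ &G(y_i^a)=(0,y_i^a),\quad G(y_*^a)=(y_*^a,0),\quad G(y_0^a)=(-y_*^a,y_0^a). \end{aligned}$$ The homomorphisms $F$ and $G$ are mutually inverse, and the composite of $G$ with the projection to $\mathfrak t^f_{g,12\cdots n0}$ is $\varepsilon^*$. -/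

import Mathlib

namespace SurfaceBraid

/-! ### The Lie algebra of framed infinitesimal braids on a closed surface of genus `g` -/

/-- The generators `t_{ij}`, `x_i^a`, `y_i^a` with `i, j` in the set `I` of strands and
`a = 1, …, g` (here `a : Fin g`). -/
inductive Gen (g : ℕ) (I : Type) : Type
  | t (i j : I) : Gen g I
  | x (a : Fin g) (i : I) : Gen g I
  | y (a : Fin g) (i : I) : Gen g I

section Presentation

variable (K : Type*) [Field K] (g : ℕ) (I : Type) [Fintype I] [DecidableEq I]

/-- The generator `t_{ij}` in the free Lie algebra. -/
noncomputable abbrev freeT (i j : I) : FreeLieAlgebra K (Gen g I) :=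
  FreeLieAlgebra.of K (Gen.t i j)

/-- The generator `x_i^a` in the free Lie algebra. -/
noncomputable abbrev freeX (a : Fin g) (i : I) : FreeLieAlgebra K (Gen g I) :=
  FreeLieAlgebra.of K (Gen.x a i)

/-- The generator `y_i^a` in the free Lie algebra. -/
noncomputable abbrev freeY (a : Fin g) (i : I) : FreeLieAlgebra K (Gen g I) :=
  FreeLieAlgebra.of K (Gen.y a i)

/-- The defining relators (left-hand side minus right-hand side of each defining relation).
Indices that are not explicitly required to be different are allowed to coincide. -/
inductive IsRelator : FreeLieAlgebra K (Gen g I) → Prop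
  | t_symm (i j : I) : IsRelator (freeT K g I i j - freeT K g I j i)
  | t_t (i j k l : I) (hik : i ≠ k) (hil : i ≠ l) (hjk : j ≠ k) (hjl : j ≠ l) :
      IsRelator ⁅freeT K g I i j, freeT K g I k l⁆
  | t_tt (i j k : I) (hik : i ≠ k) (hjk : j ≠ k) :
      IsRelator ⁅freeT K g I i j, freeT K g I i k + freeT K g I j k⁆
  | x_y (a b : Fin g) (i j : I) (hij : i ≠ j) :
      IsRelator (⁅freeX K g I a i, freeY K g I b j⁆ - if a = b then freeT K g I i j else 0)
  | x_x (a b : Fin g) (i j : I) (hij : i ≠ j) :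
      IsRelator ⁅freeX K g I a i, freeX K g I b j⁆
  | y_y (a b : Fin g) (i j : I) (hij : i ≠ j) :
      IsRelator ⁅freeY K g I a i, freeY K g I b j⁆
  | x_t (a : Fin g) (k i j : I) (hik : i ≠ k) (hjk : j ≠ k) :
      IsRelator ⁅freeX K g I a k, freeT K g I i j⁆
  | y_t (a : Fin g) (k i j : I) (hik : i ≠ k) (hjk : j ≠ k) :
      IsRelator ⁅freeY K g I a k, freeT K g I i j⁆
  | xx_t (a : Fin g) (i j : I) :
      IsRelator ⁅freeX K g I a i + freeX K g I a j, freeT K g I i j⁆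
  | yy_t (a : Fin g) (i j : I) :
      IsRelator ⁅freeY K g I a i + freeY K g I a j, freeT K g I i j⁆
  | surface (i : I) :
      IsRelator (∑ a : Fin g, ⁅freeX K g I a i, freeY K g I a i⁆
        + ∑ j ∈ Finset.univ.erase i, freeT K g I i j - ((g : K) - 1) • freeT K g I i i)

/-- The ideal generated by the relators. -/
noncomputable def relIdeal : LieIdeal K (FreeLieAlgebra K (Gen g I)) :=
  LieSubmodule.lieSpan K (FreeLieAlgebra K (Gen g I)) {r | IsRelator K g I r}

/-- The Lie algebra `𝔱^f_{g,I}`. -/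
def FramedLie : Type _ := FreeLieAlgebra K (Gen g I) ⧸ relIdeal K g I

noncomputable instance : LieRing (FramedLie K g I) :=
  inferInstanceAs (LieRing (FreeLieAlgebra K (Gen g I) ⧸ relIdeal K g I))

noncomputable instance : LieAlgebra K (FramedLie K g I) :=
  inferInstanceAs (LieAlgebra K (FreeLieAlgebra K (Gen g I) ⧸ relIdeal K g I))

/-- The quotient map from the free Lie algebra. -/
noncomputable def proj : FreeLieAlgebra K (Gen g I) →ₗ⁅K⁆ FramedLie K g I where
  toFun := LieSubmodule.Quotient.mk (N := relIdeal K g I)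
  map_add' _ _ := rfl
  map_smul' _ _ := rfl
  map_lie' := rfl

theorem proj_surjective : Function.Surjective (proj K g I) :=
  LieSubmodule.Quotient.surjective_mk' (relIdeal K g I)

variable {K g I}

theorem proj_relator {r : FreeLieAlgebra K (Gen g I)} (hr : IsRelator K g I r) :
    proj K g I r = 0 :=
  (LieSubmodule.Quotient.mk_eq_zero (N := relIdeal K g I)).2
    (LieSubmodule.subset_lieSpan hr)

variable (K g)

/-- The element `t_{ij}` of `𝔱^f_{g,I}`. -/
noncomputable def T (i j : I) : FramedLie K g I := proj K g I (freeT K g I i j)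

variable {g}

/-- The element `x_i^a` of `𝔱^f_{g,I}`. -/
noncomputable def X (a : Fin g) (i : I) : FramedLie K g I := proj K g I (freeX K g I a i)

/-- The element `y_i^a` of `𝔱^f_{g,I}`. -/
noncomputable def Y (a : Fin g) (i : I) : FramedLie K g I := proj K g I (freeY K g I a i)

variable {K}

/-- The universal property of the presentation. -/
noncomputable def liftHom {L : Type*} [LieRing L] [LieAlgebra K L] (f : Gen g I → L)
    (hf : ∀ r, IsRelator K g I r → FreeLieAlgebra.lift K f r = 0) : FramedLie K g I →ₗ⁅K⁆ L where
  toLinearMap := (relIdeal K g I).toSubmodule.liftQ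
    (FreeLieAlgebra.lift K f : FreeLieAlgebra K (Gen g I) →ₗ[K] L) (by
      have h : relIdeal K g I ≤ (FreeLieAlgebra.lift K f).ker :=
        LieSubmodule.lieSpan_le.2 fun r hr => (LieHom.mem_ker).2 (hf r hr)
      intro r hr
      exact (LieHom.mem_ker).1 (h hr))
  map_lie' := by
    intro u v
    obtain ⟨u, rfl⟩ := proj_surjective K g I u
    obtain ⟨v, rfl⟩ := proj_surjective K g I v
    exact (FreeLieAlgebra.lift K f).map_lie u v

theorem liftHom_proj {L : Type*} [LieRing L] [LieAlgebra K L] (f : Gen g I → L)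
    (hf : ∀ r, IsRelator K g I r → FreeLieAlgebra.lift K f r = 0)
    (r : FreeLieAlgebra K (Gen g I)) :
    liftHom f hf (proj K g I r) = FreeLieAlgebra.lift K f r := rfl

end Presentation

section Relations

variable {K : Type*} [Field K] {g : ℕ} {I : Type} [Fintype I] [DecidableEq I]

theorem T_symm (i j : I) : T K g i j = T K g j i := by
  have h := proj_relator (IsRelator.t_symm (K := K) (g := g) i j)
  rw [map_sub, sub_eq_zero] at h
  exact h

theorem T_T {i j k l : I} (hik : i ≠ k) (hil : i ≠ l) (hjk : j ≠ k) (hjl : j ≠ l) :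
    ⁅T K g i j, T K g k l⁆ = 0 := by
  have h := proj_relator (IsRelator.t_t (K := K) (g := g) i j k l hik hil hjk hjl)
  rw [LieHom.map_lie] at h
  exact h

theorem T_TT {i j k : I} (hik : i ≠ k) (hjk : j ≠ k) :
    ⁅T K g i j, T K g i k + T K g j k⁆ = 0 := by
  have h := proj_relator (IsRelator.t_tt (K := K) (g := g) i j k hik hjk)
  rw [LieHom.map_lie, map_add] at h
  exact h

theorem X_Y (a b : Fin g) {i j : I} (hij : i ≠ j) :
    ⁅X K a i, Y K b j⁆ = if a = b then T K g i j else 0 := by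
  have h := proj_relator (IsRelator.x_y (K := K) (g := g) a b i j hij)
  rw [map_sub, LieHom.map_lie, sub_eq_zero] at h
  refine h.trans ?_
  split_ifs
  · rfl
  · exact map_zero _

theorem X_X (a b : Fin g) {i j : I} (hij : i ≠ j) : ⁅X K a i, X K b j⁆ = 0 := by
  have h := proj_relator (IsRelator.x_x (K := K) (g := g) a b i j hij)
  rw [LieHom.map_lie] at h
  exact h

theorem Y_Y (a b : Fin g) {i j : I} (hij : i ≠ j) : ⁅Y K a i, Y K b j⁆ = 0 := by
  have h := proj_relator (IsRelator.y_y (K := K) (g := g) a b i j hij)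
  rw [LieHom.map_lie] at h
  exact h

theorem X_T (a : Fin g) {k i j : I} (hik : i ≠ k) (hjk : j ≠ k) :
    ⁅X K a k, T K g i j⁆ = 0 := by
  have h := proj_relator (IsRelator.x_t (K := K) (g := g) a k i j hik hjk)
  rw [LieHom.map_lie] at h
  exact h

theorem Y_T (a : Fin g) {k i j : I} (hik : i ≠ k) (hjk : j ≠ k) :
    ⁅Y K a k, T K g i j⁆ = 0 := by
  have h := proj_relator (IsRelator.y_t (K := K) (g := g) a k i j hik hjk)
  rw [LieHom.map_lie] at h
  exact h

theorem XX_T (a : Fin g) (i j : I) : ⁅X K a i + X K a j, T K g i j⁆ = 0 := by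
  have h := proj_relator (IsRelator.xx_t (K := K) (g := g) a i j)
  rw [LieHom.map_lie, map_add] at h
  exact h

theorem YY_T (a : Fin g) (i j : I) : ⁅Y K a i + Y K a j, T K g i j⁆ = 0 := by
  have h := proj_relator (IsRelator.yy_t (K := K) (g := g) a i j)
  rw [LieHom.map_lie, map_add] at h
  exact h

theorem surface_rel (i : I) :
    ∑ a : Fin g, ⁅X K a i, Y K a i⁆ + ∑ j ∈ Finset.univ.erase i, T K g i j
      = ((g : K) - 1) • T K g i i := by
  have h := proj_relator (IsRelator.surface (K := K) (g := g) i)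
  rw [map_sub, map_add, map_sum, map_sum, map_smul, sub_eq_zero] at h
  simp only [LieHom.map_lie] at h
  exact h

/-- Two Lie homomorphisms out of `𝔱^f_{g,I}` agree if they agree on the generators. -/
theorem hom_ext {L : Type*} [LieRing L] [LieAlgebra K L] {φ ψ : FramedLie K g I →ₗ⁅K⁆ L}
    (ht : ∀ i j, φ (T K g i j) = ψ (T K g i j)) (hx : ∀ a i, φ (X K a i) = ψ (X K a i))
    (hy : ∀ a i, φ (Y K a i) = ψ (Y K a i)) : φ = ψ := by
  have h : φ.comp (proj K g I) = ψ.comp (proj K g I) := by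
    apply FreeLieAlgebra.hom_ext
    rintro (⟨i, j⟩ | ⟨a, i⟩ | ⟨a, i⟩)
    · exact ht i j
    · exact hx a i
    · exact hy a i
  ext z
  obtain ⟨z, rfl⟩ := proj_surjective K g I z
  exact LieHom.congr_fun h z

/-- `t_{ii}` commutes with every generator. -/
theorem T_self_central [CharZero K] (i : I) (z : FramedLie K g I) : ⁅z, T K g i i⁆ = 0 := by
  have two : ∀ w : FramedLie K g I, w + w = 0 → w = 0 := by
    intro w hw
    have : (2 : K) • w = 0 := by rw [two_smul, hw]
    exact (smul_eq_zero.1 this).resolve_left two_ne_zero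
  let C : LieSubalgebra K (FreeLieAlgebra K (Gen g I)) :=
    { carrier := {w | ⁅proj K g I w, T K g i i⁆ = 0}
      add_mem' := by
        intro u v hu hv
        simp only [Set.mem_ofPred_eq] at hu hv ⊢
        rw [map_add, add_lie, hu, hv, add_zero]
      zero_mem' := by
        simp only [Set.mem_ofPred_eq]
        rw [map_zero, zero_lie]
      smul_mem' := by
        intro c u hu
        simp only [Set.mem_ofPred_eq] at hu ⊢
        rw [map_smul, smul_lie, hu, smul_zero]
      lie_mem' := by
        intro u v hu hv
        change ⁅proj K g I u, T K g i i⁆ = 0 at hu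
        change ⁅proj K g I v, T K g i i⁆ = 0 at hv
        change ⁅proj K g I ⁅u, v⁆, T K g i i⁆ = 0
        rw [LieHom.map_lie, lie_lie, hu, hv, lie_zero, lie_zero, sub_zero] }
  have hT : ∀ k l : I, ⁅T K g k l, T K g i i⁆ = 0 := by
    have key : ∀ l : I, i ≠ l → ⁅T K g i l, T K g i i⁆ = 0 := by
      intro l hl
      have h := T_TT (K := K) (g := g) (i := i) (j := i) (k := l) hl hl
      rw [lie_add] at h
      rw [← lie_skew, two _ h, neg_zero]
    intro k l
    by_cases hk : k = i
    · subst hk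
      by_cases hl : k = l
      · subst hl; exact lie_self _
      · exact key l hl
    · by_cases hl : l = i
      · subst hl
        rw [T_symm]
        exact key k (Ne.symm hk)
      · exact T_T hk hk hl hl
  have hX : ∀ (a : Fin g) (k : I), ⁅X K a k, T K g i i⁆ = 0 := by
    intro a k
    by_cases hk : i = k
    · subst hk
      have h := XX_T (K := K) a i i
      rw [add_lie] at h
      exact two _ h
    · exact X_T a hk hk
  have hY : ∀ (a : Fin g) (k : I), ⁅Y K a k, T K g i i⁆ = 0 := by
    intro a k
    by_cases hk : i = k
    · subst hk
      have h := YY_T (K := K) a i i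
      rw [add_lie] at h
      exact two _ h
    · exact Y_T a hk hk
  let f : FreeLieAlgebra K (Gen g I) →ₗ⁅K⁆ C := FreeLieAlgebra.lift K fun u =>
    ⟨FreeLieAlgebra.of K u, by
      cases u with
      | t k l => exact hT k l
      | x a k => exact hX a k
      | y a k => exact hY a k⟩
  have hf : C.incl.comp f = LieHom.id := by
    apply FreeLieAlgebra.hom_ext
    intro u
    rw [LieHom.comp_apply, FreeLieAlgebra.lift_of_apply]
    rfl
  obtain ⟨w, rfl⟩ := proj_surjective K g I z
  have h1 : (C.incl.comp f) w = w := by rw [hf]; rfl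
  have h2 : (C.incl.comp f) w ∈ C := (f w).2
  rw [h1] at h2
  exact h2

end Relations

/-! ### Substituting sets of strands: the operadic insertions -/

section Substitution

variable {K : Type*} [Field K] {g : ℕ} {I J : Type} [Fintype I] [DecidableEq I] [Fintype J]
  [DecidableEq J]

/-- The fibre of `f` over `i`, as a finite set. -/
def fib (f : J → I) (i : I) : Finset J := Finset.univ.filter fun p => f p = i

/-- Value on generators of the substitution along `f`: each index `i` is replaced by the set
`f⁻¹(i)`, and the result is expanded additively in each index. -/
noncomputable def substGen (K : Type*) [Field K] (f : J → I) : Gen g I → FramedLie K g J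
  | .t i j => ∑ p ∈ fib f i, ∑ q ∈ fib f j, T K g p q
  | .x a i => ∑ p ∈ fib f i, X K a p
  | .y a i => ∑ p ∈ fib f i, Y K a p

theorem sum_lie_T {I : Type} [DecidableEq I] (f : J → I) (V : J → FramedLie K g J) (p q : J)
    (h1 : ∀ k, (f k = f p ∨ f k = f q) → k ≠ p → k ≠ q → ⁅V k, T K g p q⁆ = 0)
    (h2 : ⁅V p + V q, T K g p q⁆ = 0) (h3 : p = q → ⁅V p, T K g p q⁆ = 0) :
    ⁅∑ k ∈ fib f (f p), V k + ∑ k ∈ fib f (f q), V k, T K g p q⁆ = 0 := by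
  have hp : p ∈ fib f (f p) := by simp [fib]
  have hq : q ∈ fib f (f q) := by simp [fib]
  rw [add_lie] at h2
  rw [add_lie, sum_lie, sum_lie]
  by_cases hpq : p = q
  · have h0 := h3 hpq
    rw [← Finset.add_sum_erase _ _ hp, ← Finset.add_sum_erase _ _ hq, Finset.sum_eq_zero,
      Finset.sum_eq_zero, ← hpq, add_zero, add_comm]
    · rw [← hpq] at h0
      rw [h0, add_zero]
    · intro k hk
      simp only [fib, Finset.mem_erase, Finset.mem_filter] at hk
      exact h1 k (Or.inr hk.2.2) (hpq ▸ hk.1) hk.1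
    · intro k hk
      simp only [fib, Finset.mem_erase, Finset.mem_filter] at hk
      exact h1 k (Or.inl hk.2.2) hk.1 (hpq ▸ hk.1)
  · by_cases hf : f p = f q
    · have hq' : q ∈ (fib f (f q)).erase p := Finset.mem_erase.2 ⟨Ne.symm hpq, hq⟩
      have hp' : p ∈ fib f (f q) := hf ▸ hp
      rw [hf, ← Finset.add_sum_erase _ _ hp', ← Finset.add_sum_erase _ _ hq',
        Finset.sum_eq_zero, add_zero, h2, add_zero]
      intro k hk
      simp only [fib, Finset.mem_erase, Finset.mem_filter] at hk
      exact h1 k (Or.inr hk.2.2.2) hk.2.1 hk.1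
    · rw [Finset.sum_eq_single_of_mem p hp, Finset.sum_eq_single_of_mem q hq, h2]
      · intro k hk hkq
        simp only [fib, Finset.mem_filter] at hk
        refine h1 k (Or.inr hk.2) ?_ hkq
        rintro rfl
        exact hf hk.2
      · intro k hk hkp
        simp only [fib, Finset.mem_filter] at hk
        refine h1 k (Or.inl hk.2) hkp ?_
        rintro rfl
        exact hf hk.2.symm

theorem lift_substGen_relator [CharZero K] (f : J → I) (r : FreeLieAlgebra K (Gen g I))
    (hr : IsRelator K g I r) : FreeLieAlgebra.lift K (substGen K f) r = 0 := by
  have mem : ∀ {p : J} {i : I}, p ∈ fib f i → f p = i := by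
    intro p i h
    simpa [fib] using h
  cases hr with
  | t_symm i j =>
    simp only [map_sub, FreeLieAlgebra.lift_of_apply, substGen]
    rw [sub_eq_zero, Finset.sum_comm]
    exact Finset.sum_congr rfl fun q _ => Finset.sum_congr rfl fun p _ => T_symm p q
  | t_t i j k l hik hil hjk hjl =>
    simp only [LieHom.map_lie, FreeLieAlgebra.lift_of_apply, substGen, sum_lie,
      lie_sum]
    refine Finset.sum_eq_zero fun p hp => Finset.sum_eq_zero fun q hq =>
      Finset.sum_eq_zero fun r hr => Finset.sum_eq_zero fun s hs => ?_
    have := mem hp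
    have := mem hq
    have := mem hr
    have := mem hs
    apply T_T <;> rintro rfl <;> simp_all
  | t_tt i j k hik hjk =>
    simp only [LieHom.map_lie, map_add, FreeLieAlgebra.lift_of_apply, substGen]
    rw [sum_lie]
    refine Finset.sum_eq_zero fun p hp => ?_
    rw [sum_lie]
    refine Finset.sum_eq_zero fun q hq => ?_
    rw [Finset.sum_comm, Finset.sum_comm (s := fib f j), ← Finset.sum_add_distrib,
      lie_sum]
    refine Finset.sum_eq_zero fun r hr => ?_
    obtain rfl := mem hp
    obtain rfl := mem hq
    obtain rfl := mem hr
    rw [← lie_skew, neg_eq_zero]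
    have hpr : p ≠ r := by rintro rfl; exact hik rfl
    have hqr : q ≠ r := by rintro rfl; exact hjk rfl
    refine sum_lie_T f (fun k => T K g k r) p q ?_ ?_ ?_
    · intro k hk hkp hkq
      refine T_T hkp hkq (Ne.symm hpr) (Ne.symm hqr)
    · rw [← lie_skew, T_TT hpr hqr, neg_zero]
    · rintro rfl
      exact T_self_central p _
  | x_y a b i j hij =>
    simp only [map_sub, LieHom.map_lie, FreeLieAlgebra.lift_of_apply, substGen]
    have : FreeLieAlgebra.lift K (substGen K f) (if a = b then freeT K g I i j else 0)
        = ∑ p ∈ fib f i, ∑ q ∈ fib f j, if a = b then T K g p q else 0 := by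
      split_ifs
      · rw [FreeLieAlgebra.lift_of_apply]; rfl
      · simp
    rw [this, sub_eq_zero, sum_lie]
    refine Finset.sum_congr rfl fun p hp => ?_
    rw [lie_sum]
    refine Finset.sum_congr rfl fun q hq => X_Y a b ?_
    rintro rfl
    exact hij ((mem hp).symm.trans (mem hq))
  | x_x a b i j hij =>
    simp only [LieHom.map_lie, FreeLieAlgebra.lift_of_apply, substGen, sum_lie,
      lie_sum]
    refine Finset.sum_eq_zero fun q hq => Finset.sum_eq_zero fun p hp => X_X a b ?_
    rintro rfl
    exact hij ((mem hp).symm.trans (mem hq))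
  | y_y a b i j hij =>
    simp only [LieHom.map_lie, FreeLieAlgebra.lift_of_apply, substGen, sum_lie,
      lie_sum]
    refine Finset.sum_eq_zero fun q hq => Finset.sum_eq_zero fun p hp => Y_Y a b ?_
    rintro rfl
    exact hij ((mem hp).symm.trans (mem hq))
  | x_t a k i j hik hjk =>
    simp only [LieHom.map_lie, FreeLieAlgebra.lift_of_apply, substGen, sum_lie,
      lie_sum]
    refine Finset.sum_eq_zero fun r hr => Finset.sum_eq_zero fun p hp =>
      Finset.sum_eq_zero fun q hq => ?_
    have := mem hp
    have := mem hq
    have := mem hr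
    apply X_T <;> rintro rfl <;> simp_all
  | y_t a k i j hik hjk =>
    simp only [LieHom.map_lie, FreeLieAlgebra.lift_of_apply, substGen, sum_lie,
      lie_sum]
    refine Finset.sum_eq_zero fun r hr => Finset.sum_eq_zero fun p hp =>
      Finset.sum_eq_zero fun q hq => ?_
    have := mem hp
    have := mem hq
    have := mem hr
    apply Y_T <;> rintro rfl <;> simp_all
  | xx_t a i j =>
    simp only [LieHom.map_lie, map_add, FreeLieAlgebra.lift_of_apply, substGen]
    rw [lie_sum]
    refine Finset.sum_eq_zero fun p hp => ?_
    rw [lie_sum]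
    refine Finset.sum_eq_zero fun q hq => ?_
    obtain rfl := mem hp
    obtain rfl := mem hq
    refine sum_lie_T f (X K a) p q ?_ (XX_T a p q) ?_
    · intro k _ hkp hkq
      exact X_T a (Ne.symm hkp) (Ne.symm hkq)
    · rintro rfl
      exact T_self_central p _
  | yy_t a i j =>
    simp only [LieHom.map_lie, map_add, FreeLieAlgebra.lift_of_apply, substGen]
    rw [lie_sum]
    refine Finset.sum_eq_zero fun p hp => ?_
    rw [lie_sum]
    refine Finset.sum_eq_zero fun q hq => ?_
    obtain rfl := mem hp
    obtain rfl := mem hq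
    refine sum_lie_T f (Y K a) p q ?_ (YY_T a p q) ?_
    · intro k _ hkp hkq
      exact Y_T a (Ne.symm hkp) (Ne.symm hkq)
    · rintro rfl
      exact T_self_central p _
  | surface i =>
    simp only [map_sub, map_add, map_sum, map_smul, LieHom.map_lie,
      FreeLieAlgebra.lift_of_apply, substGen]
    rw [sub_eq_zero]
    simp only [sum_lie]
    rw [Finset.sum_comm, Finset.sum_comm (s := Finset.univ.erase i), ← Finset.sum_add_distrib,
      Finset.smul_sum]
    refine Finset.sum_congr rfl fun p hp => ?_
    have e1 : ∀ a : Fin g, ⁅X K a p, ∑ q ∈ fib f i, Y K a q⁆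
        = ⁅X K a p, Y K a p⁆ + ∑ q ∈ (fib f i).erase p, T K g p q := by
      intro a
      rw [← Finset.add_sum_erase _ _ hp, lie_add, lie_sum]
      congr 1
      refine Finset.sum_congr rfl fun q hq => ?_
      rw [X_Y a a (Ne.symm (Finset.ne_of_mem_erase hq)), if_pos rfl]
    have e2 : ∑ q ∈ Finset.univ.erase p, T K g p q
        = ∑ q ∈ (fib f i).erase p, T K g p q
          + ∑ j ∈ Finset.univ.erase i, ∑ q ∈ fib f j, T K g p q := by
      have h : ∑ q, T K g p q = ∑ j, ∑ q ∈ fib f j, T K g p q :=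
        (Finset.sum_fiberwise Finset.univ f (fun q => T K g p q)).symm
      rw [← Finset.add_sum_erase _ _ (Finset.mem_univ p),
        ← Finset.add_sum_erase _ _ (Finset.mem_univ i), ← Finset.add_sum_erase _ _ hp,
        add_assoc] at h
      exact add_left_cancel h
    have e3 := surface_rel (K := K) (g := g) p
    rw [e2] at e3
    rw [Finset.sum_congr rfl fun a _ => e1 a, Finset.sum_add_distrib,
      ← Finset.add_sum_erase _ _ hp, smul_add, ← e3]
    simp only [Finset.sum_const, Finset.card_univ, Fintype.card_fin]
    rw [sub_smul, one_smul, Nat.cast_smul_eq_nsmul]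
    abel

variable (K g)

/-- The Lie homomorphism `𝔱^f_{g,I} → 𝔱^f_{g,J}` attached to a map `f : J → I` of finite sets,
replacing each index `i` by the set `f⁻¹(i)`:
`t_{ij} ↦ ∑_{p ∈ f⁻¹(i), q ∈ f⁻¹(j)} t_{pq}`, `x_i^a ↦ ∑_{p ∈ f⁻¹(i)} x_p^a`,
`y_i^a ↦ ∑_{p ∈ f⁻¹(i)} y_p^a`.  The operadic insertion `∘_k id_S` of a finite set `S` of strands
in place of the strand `k` is the case of the map `(I \ {k}) ⊔ S → I` that is the inclusion on
`I \ {k}` and sends `S` to `k`; the strand removal `ε^k` is the case `S = ∅`. -/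
noncomputable def substitute [CharZero K] (f : J → I) : FramedLie K g I →ₗ⁅K⁆ FramedLie K g J :=
  liftHom (substGen K f) (lift_substGen_relator f)

end Substitution

/-! ### The maps of the sequence -/

/-- The set of strands `{1, …, n, 0}`. -/
abbrev Strands (n : ℕ) : Type := Option (Fin n)

/-- The set of strands `{1, …, n, *, 0}`. -/
abbrev StrandsStar (n : ℕ) : Type := Option (Strands n)

/-- The strand `0` in `{1, …, n, 0}`. -/
abbrev zr {n : ℕ} : Strands n := none

/-- The strand `i` in `{1, …, n, 0}`. -/
abbrev pt {n : ℕ} (i : Fin n) : Strands n := some i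

/-- The strand `*` in `{1, …, n, *, 0}`. -/
abbrev starS {n : ℕ} : StrandsStar n := none

/-- The strand `0` in `{1, …, n, *, 0}`. -/
abbrev zrS {n : ℕ} : StrandsStar n := some none

/-- The strand `i` in `{1, …, n, *, 0}`. -/
abbrev ptS {n : ℕ} (i : Fin n) : StrandsStar n := some (some i)

/-- The inclusion `{1, …, n, 0} → {1, …, n, *, 0}`. -/
def inclusion (n : ℕ) : Strands n → StrandsStar n := fun p => some p

/-- The map `{1, …, n, *, 0} → {1, …, n, 0}` sending `*` and `0` to `0` and `i` to `i`. -/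
def collapse (n : ℕ) : StrandsStar n → Strands n
  | none => none
  | some p => p

section Sequence

variable (K : Type*) [Field K] (g n : ℕ)

/-- The map `ε^* : 𝔱^f_{g,12⋯n*0} → 𝔱^f_{g,12⋯n0}`, inserting the empty set at `*`. -/
noncomputable def epsStar [CharZero K] :
    FramedLie K g (StrandsStar n) →ₗ⁅K⁆ FramedLie K g (Strands n) :=
  substitute K g (inclusion n)

/-- The map `∘_0 id_{*0} : 𝔱^f_{g,12⋯n0} → 𝔱^f_{g,12⋯n*0}`, inserting the set `{*, 0}` at `0`. -/
noncomputable def doubleZero [CharZero K] :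
    FramedLie K g (Strands n) →ₗ⁅K⁆ FramedLie K g (StrandsStar n) :=
  substitute K g (collapse n)

/-- The basis `t_{k*}`, `x_*^a`, `y_*^a` of the vector space `H`. -/
inductive HBasis (g n : ℕ) : Type
  | t (k : Fin n) : HBasis g n
  | x (a : Fin g) : HBasis g n
  | y (a : Fin g) : HBasis g n

/-- The one-dimensional abelian Lie algebra `K`, with zero bracket. -/
def Line : Type _ := K

noncomputable instance : AddCommGroup (Line K) := inferInstanceAs (AddCommGroup K)

noncomputable instance : Module K (Line K) := inferInstanceAs (Module K K)

noncomputable instance : LieRing (Line K) where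
  bracket _ _ := 0
  add_lie _ _ _ := (add_zero (0 : K)).symm
  lie_add _ _ _ := (add_zero (0 : K)).symm
  lie_self _ := rfl
  leibniz_lie _ _ _ := (add_zero (0 : K)).symm

noncomputable instance : LieAlgebra K (Line K) where
  lie_smul c _ _ := (mul_zero c).symm

/-- The Lie algebra `𝔲^f_{g,12⋯n} = L(H) ⊕ K t_{**}`: the direct sum of the free Lie algebra
over `H` and of a one-dimensional abelian Lie algebra. -/
abbrev FibreLie : Type _ := FreeLieAlgebra K (HBasis g n) × Line K

/-- The generator `t_{k*}` of `𝔲^f`. -/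
noncomputable def uT (k : Fin n) : FibreLie K g n := (FreeLieAlgebra.of K (HBasis.t k), 0)

/-- The generator `x_*^a` of `𝔲^f`. -/
noncomputable def uX (a : Fin g) : FibreLie K g n := (FreeLieAlgebra.of K (HBasis.x a), 0)

/-- The generator `y_*^a` of `𝔲^f`. -/
noncomputable def uY (a : Fin g) : FibreLie K g n := (FreeLieAlgebra.of K (HBasis.y a), 0)

/-- The generator `t_{**}` of `𝔲^f`. -/
noncomputable def uSS : FibreLie K g n := (0, (1 : K))

/-- The element `ω_* = ∑_a [x_*^a, y_*^a] + ∑_j t_{j*} - (g - 1) t_{**}` of `𝔲^f`. -/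
noncomputable def omegaStar : FibreLie K g n :=
  ∑ a : Fin g, ⁅uX K g n a, uY K g n a⁆ + ∑ j : Fin n, uT K g n j
    - ((g : K) - 1) • uSS K g n

/-- The natural map `ι` on the generators of `L(H)`. -/
noncomputable def iotaGen : HBasis g n → FramedLie K g (StrandsStar n)
  | .t k => T K g (ptS k) starS
  | .x a => X K a starS
  | .y a => Y K a starS

/-- The natural map `ι : 𝔲^f_{g,12⋯n} → 𝔱^f_{g,12⋯n*0}`. -/
noncomputable def iota [CharZero K] : FibreLie K g n →ₗ⁅K⁆ FramedLie K g (StrandsStar n) where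
  toFun w := FreeLieAlgebra.lift K (iotaGen K g n) w.1
    + (show K from w.2) • T K g (starS (n := n)) starS
  map_add' u v := by
    change FreeLieAlgebra.lift K (iotaGen K g n) (u.1 + v.1)
      + ((show K from u.2) + (show K from v.2)) • T K g (starS (n := n)) starS = _
    rw [map_add, add_smul]
    abel
  map_smul' c u := by
    change FreeLieAlgebra.lift K (iotaGen K g n) (c • u.1)
      + (c * (show K from u.2)) • T K g (starS (n := n)) starS = _
    rw [map_smul, mul_smul, RingHom.id_apply, smul_add]
  map_lie' := by
    intro u v
    change FreeLieAlgebra.lift K (iotaGen K g n) ⁅u.1, v.1⁆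
      + (0 : K) • T K g (starS (n := n)) starS = _
    have h : ∀ z : FramedLie K g (StrandsStar n), ⁅T K g (starS (n := n)) starS, z⁆ = 0 := by
      intro z
      rw [← lie_skew, T_self_central, neg_zero]
    rw [zero_smul, add_zero, LieHom.map_lie, add_lie, lie_add, lie_smul, T_self_central,
      smul_lie, h, smul_zero, smul_zero, add_zero, add_zero]

variable {K g n}

/-- The table of values defining the action of `𝔱^f_{g,12⋯n0}` on `𝔲^f_{g,12⋯n}` by derivations:
`ρ z w` is the value of the generator `z` acting on the generator `w`. -/
structure IsTableAction
    (ρ : FramedLie K g (Strands n) →ₗ⁅K⁆ LieDerivation K (FibreLie K g n) (FibreLie K g n)) :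
    Prop where
  tij_t (i j k : Fin n) : ρ (T K g (pt i) (pt j)) (uT K g n k)
    = ⁅uT K g n k, (if i = k then uT K g n j else 0) + (if j = k then uT K g n i else 0)⁆
  tij_x (i j : Fin n) (b : Fin g) : ρ (T K g (pt i) (pt j)) (uX K g n b) = 0
  tij_y (i j : Fin n) (b : Fin g) : ρ (T K g (pt i) (pt j)) (uY K g n b) = 0
  tij_s (i j : Fin n) : ρ (T K g (pt i) (pt j)) (uSS K g n) = 0
  ti0_t (i k : Fin n) : ρ (T K g (pt i) zr) (uT K g n k)
    = ⁅uT K g n i + (if i = k then omegaStar K g n else 0), uT K g n k⁆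
  ti0_x (i : Fin n) (b : Fin g) : ρ (T K g (pt i) zr) (uX K g n b) = ⁅uT K g n i, uX K g n b⁆
  ti0_y (i : Fin n) (b : Fin g) : ρ (T K g (pt i) zr) (uY K g n b) = ⁅uT K g n i, uY K g n b⁆
  ti0_s (i : Fin n) : ρ (T K g (pt i) zr) (uSS K g n) = 0
  t00_t (k : Fin n) : ρ (T K g zr zr) (uT K g n k) = (2 : K) • ⁅uT K g n k, omegaStar K g n⁆
  t00_x (b : Fin g) : ρ (T K g zr zr) (uX K g n b) = (2 : K) • ⁅uX K g n b, omegaStar K g n⁆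
  t00_y (b : Fin g) : ρ (T K g zr zr) (uY K g n b) = (2 : K) • ⁅uY K g n b, omegaStar K g n⁆
  t00_s : ρ (T K g zr zr) (uSS K g n) = 0
  xi_t (i k : Fin n) (a : Fin g) : ρ (X K a (pt i)) (uT K g n k)
    = if i = k then ⁅uT K g n k, uX K g n a⁆ else 0
  xi_x (i : Fin n) (a b : Fin g) : ρ (X K a (pt i)) (uX K g n b) = 0
  xi_y (i : Fin n) (a b : Fin g) : ρ (X K a (pt i)) (uY K g n b) = if a = b then uT K g n i else 0
  xi_s (i : Fin n) (a : Fin g) : ρ (X K a (pt i)) (uSS K g n) = 0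
  x0_t (k : Fin n) (a : Fin g) : ρ (X K a zr) (uT K g n k) = ⁅uX K g n a, uT K g n k⁆
  x0_x (a b : Fin g) : ρ (X K a zr) (uX K g n b) = ⁅uX K g n a, uX K g n b⁆
  x0_y (a b : Fin g) : ρ (X K a zr) (uY K g n b)
    = ⁅uX K g n a, uY K g n b⁆ - if a = b then omegaStar K g n else 0
  x0_s (a : Fin g) : ρ (X K a zr) (uSS K g n) = 0
  yi_t (i k : Fin n) (a : Fin g) : ρ (Y K a (pt i)) (uT K g n k)
    = if i = k then ⁅uT K g n k, uY K g n a⁆ else 0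
  yi_x (i : Fin n) (a b : Fin g) : ρ (Y K a (pt i)) (uX K g n b) = if a = b then -uT K g n i else 0
  yi_y (i : Fin n) (a b : Fin g) : ρ (Y K a (pt i)) (uY K g n b) = 0
  yi_s (i : Fin n) (a : Fin g) : ρ (Y K a (pt i)) (uSS K g n) = 0
  y0_t (k : Fin n) (a : Fin g) : ρ (Y K a zr) (uT K g n k) = ⁅uY K g n a, uT K g n k⁆
  y0_x (a b : Fin g) : ρ (Y K a zr) (uX K g n b)
    = ⁅uY K g n a, uX K g n b⁆ + if a = b then omegaStar K g n else 0
  y0_y (a b : Fin g) : ρ (Y K a zr) (uY K g n b) = ⁅uY K g n a, uY K g n b⁆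
  y0_s (a : Fin g) : ρ (Y K a zr) (uSS K g n) = 0

/-- The list of values on generators defining the homomorphism
`G : 𝔱^f_{g,12⋯n*0} → 𝔲^f_{g,12⋯n} ⋊ 𝔱^f_{g,12⋯n0}`. -/
structure IsTableG
    {ρ : FramedLie K g (Strands n) →ₗ⁅K⁆ LieDerivation K (FibreLie K g n) (FibreLie K g n)}
    (G : FramedLie K g (StrandsStar n) →ₗ⁅K⁆
      LieAlgebra.SemiDirectSum (FibreLie K g n) (FramedLie K g (Strands n)) ρ) : Prop where
  tij (i j : Fin n) : G (T K g (ptS i) (ptS j)) = ⟨0, T K g (pt i) (pt j)⟩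
  tis (i : Fin n) : G (T K g (ptS i) starS) = ⟨uT K g n i, 0⟩
  ti0 (i : Fin n) : G (T K g (ptS i) zrS) = ⟨-uT K g n i, T K g (pt i) zr⟩
  tss : G (T K g starS starS) = ⟨uSS K g n, 0⟩
  ts0 : G (T K g starS zrS) = ⟨-omegaStar K g n, 0⟩
  t00 : G (T K g zrS zrS) = ⟨-uSS K g n + (2 : K) • omegaStar K g n, T K g zr zr⟩
  xi (a : Fin g) (i : Fin n) : G (X K a (ptS i)) = ⟨0, X K a (pt i)⟩
  xs (a : Fin g) : G (X K a starS) = ⟨uX K g n a, 0⟩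
  x0 (a : Fin g) : G (X K a zrS) = ⟨-uX K g n a, X K a zr⟩
  yi (a : Fin g) (i : Fin n) : G (Y K a (ptS i)) = ⟨0, Y K a (pt i)⟩
  ys (a : Fin g) : G (Y K a starS) = ⟨uY K g n a, 0⟩
  y0 (a : Fin g) : G (Y K a zrS) = ⟨-uY K g n a, Y K a zr⟩

end Sequence

end SurfaceBraid

/-! Write 𝔲 for the fibre and 𝔱_* for the Lie algebra on the strands 1, …, n, *, 0. Everything
reduces to the bijectivity of F: exactness follows from it, G is its inverse, and each entry of the
table of G is confirmed by applying F to it. Surjectivity holds because F reaches every generator.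
Since ε^* ∘ F reads off the second component, injectivity of F amounts to injectivity of ι. So two
things are needed: the relations of 𝔱_* impose nothing on 𝔲, and ι(𝔲) is an ideal on which brackets
are computed by explicit derivations.

Put τ_i = t_{i*} for 1 ≤ i ≤ n and τ_0 = -ω_*. The surface relation at * says that τ_0 represents
t_{0*}, so the strands 1, …, n, 0 play symmetric roles. Brackets with t_{ij}, x_i^a, y_i^a (i, j ≠
*) prescribe derivations of 𝔲, which exist because L(H) is free and whose formulas extend to τ_0
(`derivT_tau`, `derivX_tau`, `derivY_tau`). They satisfy the relations not involving *, while the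
surface relation at i acquires the term ad τ_i (`surface_deriv`), which accounts for t_{i*}.

Thus 𝔱_* acts on 𝔲 with the fibre acting by ad. This alone does not give injectivity of ι, as ad
kills t_{**}. The action is therefore refined to a homomorphism `holMap` into the holomorph 𝔲 ⋊
Der(𝔲), with w in the fibre going to (-w, ad w). On every generator the first component is minus the
𝔲-component in the table of G. The composite `holMap` ∘ ι is visibly injective (`iota_injective`),
and the second component of `holMap` z is the bracket with z on ι(𝔲) (`iota_action`). Pulling that
second component back along ∘_0 id_{*0} gives the required action and makes F a Lie homomorphism. -/

namespace SurfaceBraid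

/-! ### Derivations of the fibre Lie algebra -/

/-- The tangent Lie algebra `L ⊗ K[ε]/(ε²)` of a Lie algebra `L`, as the set of pairs
`a + ε b`. -/
def Tangent (L : Type*) : Type _ := L × L

section Tangent

variable {K L : Type*} [CommRing K] [LieRing L] [LieAlgebra K L]

instance : AddCommGroup (Tangent L) := inferInstanceAs (AddCommGroup (L × L))

instance : Module K (Tangent L) := inferInstanceAs (Module K (L × L))

instance : LieRing (Tangent L) where
  bracket u v := (⁅u.1, v.1⁆, ⁅u.1, v.2⁆ + ⁅u.2, v.1⁆)
  add_lie u v w := by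
    refine Prod.ext (add_lie u.1 v.1 w.1) ?_
    change ⁅u.1 + v.1, w.2⁆ + ⁅u.2 + v.2, w.1⁆
      = (⁅u.1, w.2⁆ + ⁅u.2, w.1⁆) + (⁅v.1, w.2⁆ + ⁅v.2, w.1⁆)
    rw [add_lie, add_lie]
    abel
  lie_add u v w := by
    refine Prod.ext (lie_add u.1 v.1 w.1) ?_
    change ⁅u.1, v.2 + w.2⁆ + ⁅u.2, v.1 + w.1⁆
      = (⁅u.1, v.2⁆ + ⁅u.2, v.1⁆) + (⁅u.1, w.2⁆ + ⁅u.2, w.1⁆)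
    rw [lie_add, lie_add]
    abel
  lie_self u := by
    refine Prod.ext (lie_self u.1) ?_
    change ⁅u.1, u.2⁆ + ⁅u.2, u.1⁆ = 0
    rw [← lie_skew, neg_add_cancel]
  leibniz_lie u v w := by
    refine Prod.ext (leibniz_lie u.1 v.1 w.1) ?_
    change ⁅u.1, ⁅v.1, w.2⁆ + ⁅v.2, w.1⁆⁆ + ⁅u.2, ⁅v.1, w.1⁆⁆
      = (⁅⁅u.1, v.1⁆, w.2⁆ + ⁅⁅u.1, v.2⁆ + ⁅u.2, v.1⁆, w.1⁆)
        + (⁅v.1, ⁅u.1, w.2⁆ + ⁅u.2, w.1⁆⁆ + ⁅v.2, ⁅u.1, w.1⁆⁆)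
    rw [lie_add, lie_add, add_lie, leibniz_lie u.1 v.1, leibniz_lie u.1 v.2, leibniz_lie u.2 v.1]
    abel

instance : LieAlgebra K (Tangent L) where
  lie_smul c u v := by
    refine Prod.ext (lie_smul c u.1 v.1) ?_
    change ⁅u.1, c • v.2⁆ + ⁅u.2, c • v.1⁆ = c • (⁅u.1, v.2⁆ + ⁅u.2, v.1⁆)
    rw [lie_smul, lie_smul, smul_add]

/-- The base point of a tangent vector. -/
def Tangent.base : Tangent L →ₗ⁅K⁆ L where
  toFun u := u.1
  map_add' _ _ := rfl
  map_smul' _ _ := rfl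
  map_lie' := rfl

/-- The direction of a tangent vector. -/
def Tangent.direction : Tangent L →ₗ[K] L where
  toFun u := u.2
  map_add' _ _ := rfl
  map_smul' _ _ := rfl

end Tangent

section Derivation

variable {K : Type*} [Field K] {g n : ℕ}

/-- The value on the generators of `L(H)` of the tangent map of a derivation. -/
noncomputable def tangentGen (f : HBasis g n → FibreLie K g n) (h : HBasis g n) :
    Tangent (FibreLie K g n) :=
  ((FreeLieAlgebra.of K h, 0), f h)

/-- The tangent map `w ↦ w + ε D w` of the derivation `D` with values `f`. -/
noncomputable def tangentMap (f : HBasis g n → FibreLie K g n) :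
    FreeLieAlgebra K (HBasis g n) →ₗ⁅K⁆ Tangent (FibreLie K g n) :=
  FreeLieAlgebra.lift K (tangentGen f)

/-- A Lie homomorphism into the tangent algebra whose base component is the inclusion has a
derivation as its direction component. This turns the universal property for homomorphisms into one
for derivations. -/
theorem tangentMap_fst (f : HBasis g n → FibreLie K g n) (w : FreeLieAlgebra K (HBasis g n)) :
    (tangentMap f w).1 = (w, 0) := by
  have h : (Tangent.base (K := K)).comp (tangentMap f)
      = LieHom.inl K (FreeLieAlgebra K (HBasis g n)) (Line K) := by
    apply FreeLieAlgebra.hom_ext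
    intro x
    rw [LieHom.comp_apply, tangentMap, FreeLieAlgebra.lift_of_apply]
    rfl
  exact LieHom.congr_fun h w

/-- The derivation of `𝔲^f = L(H) ⊕ K t_{**}` with prescribed values on the basis of `H`, killing
`t_{**}`. -/
noncomputable def deriv (f : HBasis g n → FibreLie K g n) :
    LieDerivation K (FibreLie K g n) (FibreLie K g n) where
  toLinearMap := (Tangent.direction.comp (tangentMap f : _ →ₗ[K] Tangent (FibreLie K g n))).comp
    (LinearMap.fst K _ _)
  leibniz' u v := by
    change (tangentMap f ⁅u.1, v.1⁆).2 = ⁅u, (tangentMap f v.1).2⁆ - ⁅v, (tangentMap f u.1).2⁆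
    -- The base component forgets the coefficient of t_{**}. This does not affect brackets, since
    -- t_{**} is central.
    have h : ∀ (w : FibreLie K g n) (z : FibreLie K g n), ⁅((w.1, 0) : FibreLie K g n), z⁆ = ⁅w, z⁆ :=
      fun _ _ => rfl
    rw [LieHom.map_lie, ← lie_skew v]
    change ⁅(tangentMap f u.1).1, (tangentMap f v.1).2⁆
      + ⁅(tangentMap f u.1).2, (tangentMap f v.1).1⁆ = _
    rw [tangentMap_fst, tangentMap_fst, h, ← lie_skew _ ((v.1, 0) : FibreLie K g n), h, ← lie_skew v]
    abel

variable (f : HBasis g n → FibreLie K g n)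

@[simp] theorem deriv_uT (k : Fin n) : deriv f (uT K g n k) = f (.t k) := by
  change (tangentMap f (FreeLieAlgebra.of K _)).2 = _
  rw [tangentMap, FreeLieAlgebra.lift_of_apply]
  rfl

@[simp] theorem deriv_uX (a : Fin g) : deriv f (uX K g n a) = f (.x a) := by
  change (tangentMap f (FreeLieAlgebra.of K _)).2 = _
  rw [tangentMap, FreeLieAlgebra.lift_of_apply]
  rfl

@[simp] theorem deriv_uY (a : Fin g) : deriv f (uY K g n a) = f (.y a) := by
  change (tangentMap f (FreeLieAlgebra.of K _)).2 = _
  rw [tangentMap, FreeLieAlgebra.lift_of_apply]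
  rfl

@[simp] theorem deriv_uSS : deriv f (uSS K g n) = 0 := by
  change (tangentMap f 0).2 = _
  rw [map_zero]
  rfl

theorem lie_uSS (w : FibreLie K g n) : ⁅w, uSS K g n⁆ = 0 :=
  Prod.ext (lie_zero w.1) rfl

theorem uSS_lie (w : FibreLie K g n) : ⁅uSS K g n, w⁆ = 0 := by
  rw [← lie_skew, lie_uSS, neg_zero]

/-- A Lie subalgebra of `𝔲^f` containing the generators is everything. -/
theorem fibre_induction (S : LieSubalgebra K (FibreLie K g n))
    (ht : ∀ k, uT K g n k ∈ S) (hx : ∀ a, uX K g n a ∈ S) (hy : ∀ a, uY K g n a ∈ S)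
    (hs : uSS K g n ∈ S) (w : FibreLie K g n) : w ∈ S := by
  let F : FreeLieAlgebra K (HBasis g n) →ₗ⁅K⁆ S := FreeLieAlgebra.lift K fun h =>
    ⟨(FreeLieAlgebra.of K h, 0), by
      cases h with
      | t k => exact ht k
      | x a => exact hx a
      | y a => exact hy a⟩
  have hF : S.incl.comp F = LieHom.inl K (FreeLieAlgebra K (HBasis g n)) (Line K) := by
    apply FreeLieAlgebra.hom_ext
    intro x
    rw [LieHom.comp_apply, FreeLieAlgebra.lift_of_apply]
    rfl
  have h1 : w = S.incl (F w.1) + (show K from w.2) • uSS K g n := by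
    rw [← LieHom.comp_apply, hF]
    refine Prod.ext ?_ ?_
    · change w.1 = w.1 + (show K from w.2) • (0 : FreeLieAlgebra K (HBasis g n))
      rw [smul_zero, add_zero]
    · exact (by rw [mul_one, zero_add] : (show K from w.2) = (0 : K) + (show K from w.2) * 1)
  rw [h1]
  exact S.add_mem (F w.1).2 (S.smul_mem _ hs)

/-- The elements on which two derivations agree. -/
def derivEqLocus (D D' : LieDerivation K (FibreLie K g n) (FibreLie K g n)) :
    LieSubalgebra K (FibreLie K g n) where
  carrier := {w | D w = D' w}
  add_mem' {u v} hu hv := by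
    change D (u + v) = D' (u + v)
    rw [map_add, map_add, hu, hv]
  zero_mem' := by
    change D 0 = D' 0
    rw [map_zero, map_zero]
  smul_mem' c u hu := by
    change D (c • u) = D' (c • u)
    rw [map_smul, map_smul, hu]
  lie_mem' {u v} hu hv := by
    change D ⁅u, v⁆ = D' ⁅u, v⁆
    rw [D.apply_lie_eq_add, D'.apply_lie_eq_add, hu, hv]

theorem derivation_ext {D D' : LieDerivation K (FibreLie K g n) (FibreLie K g n)}
    (ht : ∀ k, D (uT K g n k) = D' (uT K g n k)) (hx : ∀ a, D (uX K g n a) = D' (uX K g n a))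
    (hy : ∀ a, D (uY K g n a) = D' (uY K g n a)) (hs : D (uSS K g n) = D' (uSS K g n)) : D = D' :=
  LieDerivation.ext fun w => fibre_induction (derivEqLocus D D') ht hx hy hs w

end Derivation

/-! ### The derivations of the fibre attached to the generators -/

section FibreDerivations

variable (K : Type*) [Field K] (g n : ℕ)

/-- The elements `t_{i*}` of `𝔲^f`, with `t_{0*} = -ω_*`. -/
noncomputable def tau : Strands n → FibreLie K g n
  | none => -omegaStar K g n
  | some k => uT K g n k

theorem sum_tau : ∑ i, tau K g n i
    = ((g : K) - 1) • uSS K g n - ∑ a : Fin g, ⁅uX K g n a, uY K g n a⁆ := by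
  rw [Fintype.sum_option]
  simp only [tau, omegaStar]
  abel

theorem omegaStar_eq_neg_tau : omegaStar K g n = -tau K g n none := (neg_neg _).symm

/-- The derivation of `𝔲^f` induced by `t_{ij}`. -/
noncomputable def derivT (i j : Strands n) : LieDerivation K (FibreLie K g n) (FibreLie K g n) :=
  deriv fun
    | .t k => (if i = some k then ⁅uT K g n k, tau K g n j⁆ else 0)
        + if j = some k then ⁅uT K g n k, tau K g n i⁆ else 0
    | .x _ => 0
    | .y _ => 0

variable {g}

/-- The derivation of `𝔲^f` induced by `x_i^a`. -/
noncomputable def derivX (a : Fin g) (i : Strands n) :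
    LieDerivation K (FibreLie K g n) (FibreLie K g n) :=
  deriv fun
    | .t k => if i = some k then ⁅uT K g n k, uX K g n a⁆ else 0
    | .x _ => 0
    | .y b => if a = b then tau K g n i else 0

/-- The derivation of `𝔲^f` induced by `y_i^a`. -/
noncomputable def derivY (a : Fin g) (i : Strands n) :
    LieDerivation K (FibreLie K g n) (FibreLie K g n) :=
  deriv fun
    | .t k => if i = some k then ⁅uT K g n k, uY K g n a⁆ else 0
    | .x b => if a = b then -tau K g n i else 0
    | .y _ => 0

variable {K n}

/-! ### Values of the derivations on x, y, t_{**} and on all τ_i. -/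

section Values

variable (i j : Strands n) (a b : Fin g)

@[simp] theorem derivT_uX : derivT K g n i j (uX K g n b) = 0 := deriv_uX _ _
@[simp] theorem derivT_uY : derivT K g n i j (uY K g n b) = 0 := deriv_uY _ _
@[simp] theorem derivT_uSS : derivT K g n i j (uSS K g n) = 0 := deriv_uSS _
@[simp] theorem derivX_uX : derivX K n a i (uX K g n b) = 0 := deriv_uX _ _
@[simp] theorem derivX_uY :
    derivX K n a i (uY K g n b) = if a = b then tau K g n i else 0 := deriv_uY _ _
@[simp] theorem derivX_uSS : derivX K n a i (uSS K g n) = 0 := deriv_uSS _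
@[simp] theorem derivY_uX :
    derivY K n a i (uX K g n b) = if a = b then -tau K g n i else 0 := deriv_uX _ _
@[simp] theorem derivY_uY : derivY K n a i (uY K g n b) = 0 := deriv_uY _ _
@[simp] theorem derivY_uSS : derivY K n a i (uSS K g n) = 0 := deriv_uSS _

/-- Expands τ_0 = -ω_*. It serves to show that the formulas prescribed on τ_1, …, τ_n also hold at
τ_0, so that the relations below can be checked without singling out the strand 0. -/
theorem derivation_tau_none (D : LieDerivation K (FibreLie K g n) (FibreLie K g n)) :
    D (tau K g n none) = ((g : K) - 1) • D (uSS K g n)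
      - ∑ a : Fin g, (⁅uX K g n a, D (uY K g n a)⁆ + ⁅D (uX K g n a), uY K g n a⁆)
      - ∑ k, D (uT K g n k) := by
  simp only [tau, omegaStar, map_neg, map_sub, map_add, map_sum, map_smul,
    LieDerivation.apply_lie_eq_add]
  abel

-- The derivation kills all x, y and t_{**}, hence the sum of all τ by `sum_tau`. Its value at τ_0
-- is thus minus the sum of its values at τ_1, …, τ_n: two opposite brackets if neither i nor j is
-- 0, a single bracket if exactly one of them is.
@[simp] theorem derivT_tau (m : Strands n) : derivT K g n i j (tau K g n m)
    = (if i = m then ⁅tau K g n m, tau K g n j⁆ else 0)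
      + if j = m then ⁅tau K g n m, tau K g n i⁆ else 0 := by
  have ht : ∀ k, derivT K g n i j (uT K g n k)
      = (if i = some k then ⁅tau K g n (some k), tau K g n j⁆ else 0)
        + if j = some k then ⁅tau K g n (some k), tau K g n i⁆ else 0 := fun k => deriv_uT _ _
  cases m with
  | some k => exact ht k
  | none =>
    rw [derivation_tau_none]
    simp only [ht, derivT_uX, derivT_uY, derivT_uSS, Finset.sum_add_distrib]
    have h := lie_skew (tau K g n i) (tau K g n j)
    -- The bracket of 𝔲 is kept whole here and below, rather than split into its components in L(H)
    -- and in K t_{**}, so that identities such as Jacobi remain applicable.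
    cases i <;> cases j <;> simp [-LieAlgebra.Prod.bracket_apply]
    rw [← h, neg_add_cancel]

-- At τ_0 the value y^a ↦ τ_i contributes -[x^a, τ_i] = [τ_i, x^a]. For i ≠ 0 it cancels against the
-- value at t_{i*}; for i = 0 it is the whole answer.
@[simp] theorem derivX_tau (m : Strands n) : derivX K n a i (tau K g n m)
    = if i = m then ⁅tau K g n m, uX K g n a⁆ else 0 := by
  have ht : ∀ k, derivX K n a i (uT K g n k)
      = if i = some k then ⁅tau K g n (some k), uX K g n a⁆ else 0 := fun k => deriv_uT _ _
  cases m with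
  | some k => exact ht k
  | none =>
    rw [derivation_tau_none]
    simp only [ht, derivX_uX, derivX_uY, derivX_uSS]
    cases i <;> simp [-LieAlgebra.Prod.bracket_apply, apply_ite (Bracket.bracket (uX K g n _))]

@[simp] theorem derivY_tau (m : Strands n) : derivY K n a i (tau K g n m)
    = if i = m then ⁅tau K g n m, uY K g n a⁆ else 0 := by
  have ht : ∀ k, derivY K n a i (uT K g n k)
      = if i = some k then ⁅tau K g n (some k), uY K g n a⁆ else 0 := fun k => deriv_uT _ _
  cases m with
  | some k => exact ht k
  | none =>
    rw [derivation_tau_none]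
    simp only [ht, derivY_uX, derivY_uY, derivY_uSS]
    have h : ∀ b, ⁅if a = b then -tau K g n i else 0, uY K g n b⁆
        = if a = b then -⁅tau K g n i, uY K g n b⁆ else 0 := by
      intro b
      split_ifs <;> simp
    cases i <;> simp [h]

end Values

/-! ### Relations among the derivations. -/

theorem derivation_ext_tau {D D' : LieDerivation K (FibreLie K g n) (FibreLie K g n)}
    (ht : ∀ k, D (tau K g n k) = D' (tau K g n k)) (hx : ∀ a, D (uX K g n a) = D' (uX K g n a))
    (hy : ∀ a, D (uY K g n a) = D' (uY K g n a)) (hs : D (uSS K g n) = D' (uSS K g n)) : D = D' :=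
  derivation_ext (fun k => ht (some k)) hx hy hs

theorem derivT_comm (i j : Strands n) : derivT K g n i j = derivT K g n j i :=
  derivation_ext_tau (fun m => by simp [add_comm]) (by simp) (by simp) (by simp)

/-- The only possible values are multiples of [τ_i, τ_i]. This matches the centrality of t_{ii}, and
it is why no framing term appears in `surface_deriv`. -/
theorem derivT_self (i : Strands n) : derivT K g n i i = 0 :=
  derivation_ext_tau (fun m => by
    by_cases h : i = m
    · subst h; simp
    · simp [h]) (by simp) (by simp) (by simp)

theorem derivT_derivT {i j k l : Strands n} (hik : i ≠ k) (hil : i ≠ l) (hjk : j ≠ k)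
    (hjl : j ≠ l) : ⁅derivT K g n i j, derivT K g n k l⁆ = 0 := by
  have hik' := hik.symm
  have hil' := hil.symm
  have hjk' := hjk.symm
  have hjl' := hjl.symm
  refine derivation_ext_tau (fun m => ?_) (by simp) (by simp) (by simp)
  by_cases h1 : i = m <;> by_cases h2 : j = m <;> by_cases h3 : k = m <;> by_cases h4 : l = m <;>
    simp_all [-LieAlgebra.Prod.bracket_apply]

theorem derivX_derivX {i j : Strands n} (a b : Fin g) (hij : i ≠ j) :
    ⁅derivX K n a i, derivX K n b j⁆ = 0 := by
  have hij' := hij.symm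
  refine derivation_ext_tau (fun m => ?_) (by simp) (fun c => ?_) (by simp)
  · by_cases h1 : i = m <;> by_cases h2 : j = m <;> simp_all [-LieAlgebra.Prod.bracket_apply]
  · by_cases h1 : a = c <;> by_cases h2 : b = c <;> simp [h1, h2, hij, hij.symm]

theorem derivY_derivY {i j : Strands n} (a b : Fin g) (hij : i ≠ j) :
    ⁅derivY K n a i, derivY K n b j⁆ = 0 := by
  have hij' := hij.symm
  refine derivation_ext_tau (fun m => ?_) (fun c => ?_) (by simp) (by simp)
  · by_cases h1 : i = m <;> by_cases h2 : j = m <;> simp_all [-LieAlgebra.Prod.bracket_apply]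
  · by_cases h1 : a = c <;> by_cases h2 : b = c <;> simp [h1, h2, hij, hij.symm]

theorem derivX_derivY {i j : Strands n} (a b : Fin g) (hij : i ≠ j) :
    ⁅derivX K n a i, derivY K n b j⁆ = if a = b then derivT K g n i j else 0 := by
  have hab : (b = a) = (a = b) := propext eq_comm
  have hij' := hij.symm
  refine derivation_ext_tau (fun m => ?_) (fun c => ?_) (fun c => ?_) ?_
  · by_cases h : a = b <;> by_cases h1 : i = m <;> by_cases h2 : j = m <;>
      simp_all [-LieAlgebra.Prod.bracket_apply]
  · by_cases h : a = b <;> by_cases h1 : a = c <;> by_cases h2 : b = c <;> simp_all [-LieAlgebra.Prod.bracket_apply, eq_comm]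
  · by_cases h : a = b <;> by_cases h1 : a = c <;> by_cases h2 : b = c <;> simp_all [-LieAlgebra.Prod.bracket_apply, eq_comm]
  · by_cases h : a = b <;> simp [h]

theorem derivX_derivT {i j k : Strands n} (a : Fin g) (hik : i ≠ k) (hjk : j ≠ k) :
    ⁅derivX K n a k, derivT K g n i j⁆ = 0 := by
  have hik' := hik.symm
  have hjk' := hjk.symm
  refine derivation_ext_tau (fun m => ?_) (by simp) (fun c => ?_) (by simp)
  · by_cases h1 : i = m <;> by_cases h2 : j = m <;> by_cases h3 : k = m <;>
      simp_all [-LieAlgebra.Prod.bracket_apply]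
  · by_cases h1 : a = c <;> simp [h1, hik, hjk]

theorem derivY_derivT {i j k : Strands n} (a : Fin g) (hik : i ≠ k) (hjk : j ≠ k) :
    ⁅derivY K n a k, derivT K g n i j⁆ = 0 := by
  have hik' := hik.symm
  have hjk' := hjk.symm
  refine derivation_ext_tau (fun m => ?_) (fun c => ?_) (by simp) (by simp)
  · by_cases h1 : i = m <;> by_cases h2 : j = m <;> by_cases h3 : k = m <;>
      simp_all [-LieAlgebra.Prod.bracket_apply]
  · by_cases h1 : a = c <;> simp [h1, hik, hjk]

theorem lie_lie_neg {L : Type*} [LieRing L] (u v w : L) : ⁅u, ⁅v, w⁆⁆ = -⁅u, ⁅w, v⁆⁆ := by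
  rw [← lie_neg, lie_skew]

theorem derivXX_derivT {i j : Strands n} (a : Fin g) (hij : i ≠ j) :
    ⁅derivX K n a i + derivX K n a j, derivT K g n i j⁆ = 0 := by
  have hij' := hij.symm
  refine derivation_ext_tau (fun m => ?_) (by simp) (fun c => ?_) (by simp)
  · by_cases h1 : i = m <;> by_cases h2 : j = m <;> simp_all [-LieAlgebra.Prod.bracket_apply]
    · have h := lie_jacobi (tau K g n m) (uX K g n a) (tau K g n j)
      rw [lie_lie_neg (uX K g n a)] at h
      linear_combination (norm := abel) h
    · have h := lie_jacobi (tau K g n m) (uX K g n a) (tau K g n i)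
      rw [lie_lie_neg (uX K g n a)] at h
      linear_combination (norm := abel) h
  · by_cases h1 : a = c <;> simp [h1, hij, hij.symm, -LieAlgebra.Prod.bracket_apply]
    rw [← lie_skew, neg_add_cancel]

theorem derivYY_derivT {i j : Strands n} (a : Fin g) (hij : i ≠ j) :
    ⁅derivY K n a i + derivY K n a j, derivT K g n i j⁆ = 0 := by
  have hij' := hij.symm
  refine derivation_ext_tau (fun m => ?_) (fun c => ?_) (by simp) (by simp)
  · by_cases h1 : i = m <;> by_cases h2 : j = m <;> simp_all [-LieAlgebra.Prod.bracket_apply]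
    · have h := lie_jacobi (tau K g n m) (uY K g n a) (tau K g n j)
      rw [lie_lie_neg (uY K g n a)] at h
      linear_combination (norm := abel) h
    · have h := lie_jacobi (tau K g n m) (uY K g n a) (tau K g n i)
      rw [lie_lie_neg (uY K g n a)] at h
      linear_combination (norm := abel) h
  · by_cases h1 : a = c <;> simp [h1, hij, hij.symm, -LieAlgebra.Prod.bracket_apply]
    rw [← lie_skew, neg_add_cancel]

/-- Only the values at τ_i, τ_j, τ_k can be nonzero. The first two vanish by the Jacobi identity,
the third by antisymmetry. -/
theorem derivT_derivTT {i j k : Strands n} (hij : i ≠ j) (hik : i ≠ k) (hjk : j ≠ k) :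
    ⁅derivT K g n i j, derivT K g n i k + derivT K g n j k⁆ = 0 := by
  have hij' := hij.symm
  have hik' := hik.symm
  have hjk' := hjk.symm
  refine derivation_ext_tau (fun m => ?_) (by simp) (by simp) (by simp)
  by_cases h1 : i = m <;> by_cases h2 : j = m <;> by_cases h3 : k = m <;>
    simp_all [-LieAlgebra.Prod.bracket_apply]
  · have h := lie_jacobi (tau K g n m) (tau K g n j) (tau K g n k)
    rw [lie_lie_neg _ _ (tau K g n j), lie_lie_neg _ (tau K g n m) (tau K g n k),
      lie_lie_neg (tau K g n k) (tau K g n j)]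
    linear_combination (norm := abel) (2 : ℤ) • h
  · have h := lie_jacobi (tau K g n i) (tau K g n k) (tau K g n m)
    rw [lie_lie_neg _ _ (tau K g n i), lie_lie_neg _ (tau K g n m) (tau K g n k),
      lie_lie_neg (tau K g n k) (tau K g n i)]
    linear_combination (norm := abel) (2 : ℤ) • h
  · rw [lie_lie_neg, neg_add_cancel]

theorem derivation_sum_apply {ι : Type*} (s : Finset ι)
    (D : ι → LieDerivation K (FibreLie K g n) (FibreLie K g n)) (w : FibreLie K g n) :
    (∑ i ∈ s, D i) w = ∑ i ∈ s, D i w := by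
  classical
  induction s using Finset.induction_on with
  | empty => rfl
  | insert i s hi ih => rw [Finset.sum_insert hi, Finset.sum_insert hi, LieDerivation.add_apply, ih]

/-- The sum over the strands other than i in the surface relation of 𝔱_* includes t_{i*}, which acts
as ad τ_i. Without that term the relation fails, so these derivations do not by themselves define
the action of the Lie algebra on 1, …, n, 0. -/
theorem surface_deriv (i : Strands n) :
    ∑ a : Fin g, ⁅derivX K n a i, derivY K n a i⁆
      + (LieDerivation.ad K (FibreLie K g n) (tau K g n i)
        + ∑ j ∈ Finset.univ.erase i, derivT K g n i j) = 0 := by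
  have had : ∀ w, LieDerivation.ad K (FibreLie K g n) (tau K g n i) w = ⁅tau K g n i, w⁆ := by
    intro w
    simp
  refine derivation_ext_tau (fun m => ?_) (fun c => ?_) (fun c => ?_) ?_ <;>
    simp only [LieDerivation.add_apply, derivation_sum_apply, LieDerivation.zero_apply, had,
      LieDerivation.commutator_apply]
  · by_cases h : i = m
    · subst h
      have hxy : ∀ a : Fin g, derivX K n a i (derivY K n a i (tau K g n i))
          - derivY K n a i (derivX K n a i (tau K g n i))
          = ⁅tau K g n i, ⁅uX K g n a, uY K g n a⁆⁆ := by
        intro a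
        simp [-LieAlgebra.Prod.bracket_apply]
        have h := lie_jacobi (tau K g n i) (uX K g n a) (uY K g n a)
        rw [lie_lie_neg _ (uY K g n a)] at h ⊢
        linear_combination (norm := abel) h
      have hT : ∀ j ∈ Finset.univ.erase i, derivT K g n i j (tau K g n i)
          = ⁅tau K g n i, tau K g n j⁆ := by
        intro j hj
        simp [(Finset.ne_of_mem_erase hj), -LieAlgebra.Prod.bracket_apply]
      -- The inner term [τ_i, τ_i] supplies the missing index j = i. The total is the bracket of τ_i
      -- with ∑ [x, y] + ∑ τ, which is a multiple of t_{**} by `sum_tau`.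
      rw [Finset.sum_congr rfl fun a _ => hxy a, Finset.sum_congr rfl hT,
        Finset.add_sum_erase _ (fun j => ⁅tau K g n i, tau K g n j⁆) (Finset.mem_univ i)]
      rw [← lie_sum, ← lie_sum, ← lie_add, sum_tau,
        add_sub_cancel, lie_smul, lie_uSS, smul_zero]
    -- For m ≠ i only the inner term and the summand j = m act nontrivially on τ_m, and they are
    -- opposite.
    · rw [Finset.sum_eq_zero, zero_add,
        Finset.sum_eq_single_of_mem m (Finset.mem_erase.2 ⟨Ne.symm h, Finset.mem_univ m⟩)]
      · simp [h, -LieAlgebra.Prod.bracket_apply]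
        rw [← lie_skew, neg_add_cancel]
      · intro j _ hj
        simp [h, hj]
      · simp [h]
  · simp [-LieAlgebra.Prod.bracket_apply]
    rw [Finset.sum_eq_single_of_mem c (Finset.mem_univ c)]
    · simp [-LieAlgebra.Prod.bracket_apply]
      rw [← lie_skew, neg_add_cancel]
    · intro a _ ha
      simp [ha]
  · simp [-LieAlgebra.Prod.bracket_apply]
    rw [Finset.sum_eq_single_of_mem c (Finset.mem_univ c)]
    · simp [-LieAlgebra.Prod.bracket_apply]
      rw [← lie_skew, neg_add_cancel]
    · intro a _ ha
      simp [ha]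
  · simp [lie_uSS, -LieAlgebra.Prod.bracket_apply]

end FibreDerivations

/-! ### The holomorph of the fibre -/

section Holomorph

open LieAlgebra

variable (K : Type*) [Field K] (g n : ℕ)

/-- The Lie algebra of derivations of the fibre. -/
abbrev Der : Type _ := LieDerivation K (FibreLie K g n) (FibreLie K g n)

/-- The holomorph `𝔲^f ⋊ Der(𝔲^f)` of the fibre. -/
abbrev Hol : Type _ :=
  SemiDirectSum (FibreLie K g n) (Der K g n)
    (LieHom.id : Der K g n →ₗ⁅K⁆ Der K g n)

/-- The embedding `w ↦ (-w, ad w)` of the fibre into its holomorph, whose image is the centralizer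
of the fibre. -/
noncomputable def antiDiag : FibreLie K g n →ₗ⁅K⁆ Hol K g n where
  toFun w := ⟨-w, LieDerivation.ad K _ w⟩
  map_add' u v := by
    rw [SemiDirectSum.add_eq_mk, neg_add, map_add]
  map_smul' c u := by
    rw [SemiDirectSum.smul_eq_mk, smul_neg, map_smul, RingHom.id_apply]
  map_lie' {u v} := by
    rw [SemiDirectSum.lie_eq_mk, LieHom.map_lie]
    refine SemiDirectSum.ext ?_ rfl
    simp [-Prod.bracket_apply]

variable {K g n}

@[simp] theorem antiDiag_left (w : FibreLie K g n) : (antiDiag K g n w).left = -w := rfl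

@[simp] theorem antiDiag_right (w : FibreLie K g n) :
    (antiDiag K g n w).right = LieDerivation.ad K _ w := rfl

/-- Elements (-w, ad w) commute with the fibre, so only the derivation part of z acts on them. The
first components chosen in `holT`, `holX`, `holY` therefore play no role in brackets with the
generators carrying *. -/
theorem lie_antiDiag (z : Hol K g n) (w : FibreLie K g n) :
    ⁅z, antiDiag K g n w⁆ = antiDiag K g n (z.right w) := by
  refine SemiDirectSum.ext ?_ ?_
  · simp [-Prod.bracket_apply]
  · exact LieDerivation.lie_der_ad_eq_ad_der _ _

theorem antiDiag_lie (z : Hol K g n) (w : FibreLie K g n) :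
    ⁅antiDiag K g n w, z⁆ = -antiDiag K g n (z.right w) := by
  rw [← lie_skew, lie_antiDiag]

/-- The first component retains w. The second, ad w, would lose the centre of 𝔲. -/
theorem antiDiag_injective : Function.Injective (antiDiag K g n) := fun _ _ h =>
  neg_injective (congrArg SemiDirectSum.left h)

/-- The indicator function of the strand `0`. -/
def delta (K : Type*) [Field K] {n : ℕ} : Strands n → K
  | none => 1
  | some _ => 0

@[simp] theorem delta_none : delta K (none : Strands n) = 1 := rfl

@[simp] theorem delta_some (i : Fin n) : delta K (some i : Strands n) = 0 := rfl

variable (K g) in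
/-- The image of `t_{ij}` in the holomorph. -/
noncomputable def holT (i j : Strands n) : Hol K g n :=
  ⟨delta K j • tau K g n i + delta K i • tau K g n j + (delta K i * delta K j) • uSS K g n,
    derivT K g n i j⟩

variable (K) in
/-- The image of `x_i^a` in the holomorph. -/
noncomputable def holX (a : Fin g) (i : Strands n) : Hol K g n :=
  ⟨delta K i • uX K g n a, derivX K n a i⟩

variable (K) in
/-- The image of `y_i^a` in the holomorph. -/
noncomputable def holY (a : Fin g) (i : Strands n) : Hol K g n :=
  ⟨delta K i • uY K g n a, derivY K n a i⟩

/-! ### Relations in the holomorph. -/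

theorem holT_comm (i j : Strands n) : holT K g i j = holT K g j i := by
  refine SemiDirectSum.ext ?_ (derivT_comm i j)
  simp only [holT]
  rw [mul_comm, add_comm (delta K j • _)]

/-- In this and the following relations the second components are already known from the
derivations. Only the first components remain, and those of the generators vanish unless the strand
0 occurs. -/
theorem holT_holT {i j k l : Strands n} (hik : i ≠ k) (hil : i ≠ l) (hjk : j ≠ k)
    (hjl : j ≠ l) : ⁅holT K g i j, holT K g k l⁆ = 0 := by
  have hik' := hik.symm
  have hil' := hil.symm
  have hjk' := hjk.symm
  have hjl' := hjl.symm
  refine SemiDirectSum.ext ?_ (derivT_derivT hik hil hjk hjl)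
  rcases i with _ | i <;> rcases j with _ | j <;> rcases k with _ | k <;> rcases l with _ | l <;>
    simp_all [-Prod.bracket_apply, holT]

theorem holX_holX {i j : Strands n} (a b : Fin g) (hij : i ≠ j) :
    ⁅holX K a i, holX K b j⁆ = 0 := by
  refine SemiDirectSum.ext ?_ (derivX_derivX a b hij)
  rcases i with _ | i <;> rcases j with _ | j <;>
    simp_all [-Prod.bracket_apply, holX]

theorem holY_holY {i j : Strands n} (a b : Fin g) (hij : i ≠ j) :
    ⁅holY K a i, holY K b j⁆ = 0 := by
  refine SemiDirectSum.ext ?_ (derivY_derivY a b hij)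
  rcases i with _ | i <;> rcases j with _ | j <;>
    simp_all [-Prod.bracket_apply, holY]

theorem holX_holY {i j : Strands n} (a b : Fin g) (hij : i ≠ j) :
    ⁅holX K a i, holY K b j⁆ = if a = b then holT K g i j else 0 := by
  have hab : (b = a) = (a = b) := propext eq_comm
  refine SemiDirectSum.ext ?_ ?_
  · by_cases h : a = b <;> rcases i with _ | i <;> rcases j with _ | j <;>
      simp_all [-Prod.bracket_apply, holX, holY, holT]
  · refine (derivX_derivY a b hij).trans ?_
    split_ifs <;> rfl

theorem holX_holT {i j k : Strands n} (a : Fin g) (hik : i ≠ k) (hjk : j ≠ k) :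
    ⁅holX K a k, holT K g i j⁆ = 0 := by
  have hik' := hik.symm
  have hjk' := hjk.symm
  refine SemiDirectSum.ext ?_ (derivX_derivT a hik hjk)
  rcases i with _ | i <;> rcases j with _ | j <;> rcases k with _ | k <;>
    simp_all [-Prod.bracket_apply, holX, holT]

theorem holY_holT {i j k : Strands n} (a : Fin g) (hik : i ≠ k) (hjk : j ≠ k) :
    ⁅holY K a k, holT K g i j⁆ = 0 := by
  have hik' := hik.symm
  have hjk' := hjk.symm
  refine SemiDirectSum.ext ?_ (derivY_derivT a hik hjk)
  rcases i with _ | i <;> rcases j with _ | j <;> rcases k with _ | k <;>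
    simp_all [-Prod.bracket_apply, holY, holT]

theorem holXX_holT (a : Fin g) (i j : Strands n) :
    ⁅holX K a i + holX K a j, holT K g i j⁆ = 0 := by
  by_cases hij : i = j
  · subst hij
    refine SemiDirectSum.ext ?_ ?_
    · rcases i with _ | i <;>
        simp [-Prod.bracket_apply, holX, holT, derivT_self, lie_uSS]
      rw [← lie_skew (uX K g n a)]
      abel
    · simp [holT, derivT_self]
  · have hij' := Ne.symm hij
    refine SemiDirectSum.ext ?_ (derivXX_derivT a hij)
    rcases i with _ | i <;> rcases j with _ | j <;>
      simp_all [-Prod.bracket_apply, holX, holT]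
    all_goals rw [← lie_skew, neg_add_cancel]

theorem holYY_holT (a : Fin g) (i j : Strands n) :
    ⁅holY K a i + holY K a j, holT K g i j⁆ = 0 := by
  by_cases hij : i = j
  · subst hij
    refine SemiDirectSum.ext ?_ ?_
    · rcases i with _ | i <;>
        simp [-Prod.bracket_apply, holY, holT, derivT_self, lie_uSS]
      rw [← lie_skew (uY K g n a)]
      abel
    · simp [holT, derivT_self]
  · have hij' := Ne.symm hij
    refine SemiDirectSum.ext ?_ (derivYY_derivT a hij)
    rcases i with _ | i <;> rcases j with _ | j <;>
      simp_all [-Prod.bracket_apply, holY, holT]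
    all_goals rw [← lie_skew, neg_add_cancel]

theorem holT_holTT {i j k : Strands n} (hik : i ≠ k) (hjk : j ≠ k) :
    ⁅holT K g i j, holT K g i k + holT K g j k⁆ = 0 := by
  have hik' := hik.symm
  have hjk' := hjk.symm
  by_cases hij : i = j
  · subst hij
    refine SemiDirectSum.ext ?_ ?_
    · rcases i with _ | i <;> rcases k with _ | k <;>
        simp_all [-Prod.bracket_apply, holT, derivT_self, uSS_lie]
    · simp [holT, derivT_self]
  · have hij' := Ne.symm hij
    refine SemiDirectSum.ext ?_ (derivT_derivTT hij hik hjk)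
    rcases i with _ | i <;> rcases j with _ | j <;> rcases k with _ | k <;>
      simp_all [-Prod.bracket_apply, holT]
    rw [← lie_skew, neg_add_cancel]

/-- For i ≠ 0 the first components on the left cancel, -τ_i against the τ_i from j = 0. For i = 0
each a contributes [x^a, y^a] + 2τ_0, and by `sum_tau` both sides become (g - 1)(2τ_0 + t_{**}). -/
theorem surface_hol (i : Strands n) :
    ∑ a : Fin g, ⁅holX K a i, holY K a i⁆
      + (antiDiag K g n (tau K g n i) + ∑ j ∈ Finset.univ.erase i, holT K g i j)
      = ((g : K) - 1) • holT K g i i := by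
  refine SemiDirectSum.ext ?_ ?_
  · have hl : ∀ z : Hol K g n, z.left = SemiDirectSum.projl _ z := fun _ => rfl
    rw [hl, hl]
    simp only [map_add, map_sum, map_smul, SemiDirectSum.projl_mk, SemiDirectSum.lie_eq_mk]
    rcases i with _ | i <;> simp [-Prod.bracket_apply, holX, holY, holT]
    have h := sum_tau K g n
    rw [Fintype.sum_option] at h
    simp only [Finset.sum_add_distrib, Finset.sum_const, Finset.card_univ, Fintype.card_fin]
    linear_combination (norm := module) h
  · have hr : ∀ z : Hol K g n, z.right = SemiDirectSum.projr _ z := fun _ => rfl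
    rw [hr, hr]
    simp only [map_add, map_sum, map_smul, LieHom.map_lie]
    refine (surface_deriv i).trans ?_
    change 0 = ((g : K) - 1) • derivT K g n i i
    rw [derivT_self, smul_zero]

end Holomorph

/-! ### The map to the holomorph and the injectivity of `ι` -/

section HolMap

open LieAlgebra

variable {K : Type*} [Field K] {g n : ℕ}

theorem sum_erase_none {M : Type*} [AddCommGroup M] {ι : Type*} [Fintype ι] [DecidableEq ι]
    (f : Option ι → M) : ∑ p ∈ Finset.univ.erase none, f p = ∑ i, f (some i) := by
  have h := Finset.add_sum_erase _ f (Finset.mem_univ none)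
  rw [Fintype.sum_option] at h
  exact add_left_cancel h

theorem sum_erase_some {M : Type*} [AddCommGroup M] {ι : Type*} [Fintype ι] [DecidableEq ι]
    (f : Option ι → M) (i : ι) : ∑ p ∈ Finset.univ.erase (some i), f p
      = f none + ∑ j ∈ Finset.univ.erase i, f (some j) := by
  have h := Finset.add_sum_erase _ f (Finset.mem_univ (some i))
  rw [Fintype.sum_option, ← Finset.add_sum_erase _ _ (Finset.mem_univ i), add_left_comm] at h
  exact add_left_cancel h

@[simp] theorem holT_right (i j : Strands n) : (holT K g i j).right = derivT K g n i j := rfl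

@[simp] theorem holX_right (a : Fin g) (i : Strands n) :
    (holX K a i).right = derivX K n a i := rfl

@[simp] theorem holY_right (a : Fin g) (i : Strands n) :
    (holY K a i).right = derivY K n a i := rfl

/-! ### The map to the holomorph on generators and relators. -/

variable (K g n) in
/-- The values on generators of the map `𝔱^f_{g,12⋯n*0} → 𝔲^f ⋊ Der(𝔲^f)`. -/
noncomputable def holGen : Gen g (StrandsStar n) → Hol K g n
  | .t (some i) (some j) => holT K g i j
  | .t (some i) none => antiDiag K g n (tau K g n i)
  | .t none (some j) => antiDiag K g n (tau K g n j)
  | .t none none => antiDiag K g n (uSS K g n)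
  | .x a (some i) => holX K a i
  | .x a none => antiDiag K g n (uX K g n a)
  | .y a (some i) => holY K a i
  | .y a none => antiDiag K g n (uY K g n a)

/-- The relation [t_{ij}, t_{i*} + t_{j*}] = 0, seen in the fibre. -/
theorem derivT_add_tau (i j : Strands n) :
    derivT K g n i j (tau K g n i) + derivT K g n i j (tau K g n j) = 0 := by
  by_cases h : i = j
  · subst h
    simp [derivT_self]
  · simp only [derivT_tau, if_pos, if_neg h, if_neg (Ne.symm h), add_zero, zero_add]
    rw [← lie_skew, neg_add_cancel]

theorem holT_antiDiag {i j k : Strands n} (hik : i ≠ k) (hjk : j ≠ k) :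
    ⁅holT K g i j, antiDiag K g n (tau K g n k)⁆ = 0 := by
  rw [lie_antiDiag, holT_right, derivT_tau, if_neg hik, if_neg hjk, add_zero, map_zero]

theorem holT_antiDiag_uSS (i j : Strands n) :
    ⁅holT K g i j, antiDiag K g n (uSS K g n)⁆ = 0 := by
  rw [lie_antiDiag, holT_right, derivT_uSS, map_zero]

theorem holGen_t_t {i j k l : StrandsStar n} (hik : i ≠ k) (hil : i ≠ l) (hjk : j ≠ k)
    (hjl : j ≠ l) : ⁅holGen K g n (.t i j), holGen K g n (.t k l)⁆ = 0 := by
  have some_ne : ∀ {p q : Strands n}, (some p : StrandsStar n) ≠ some q → p ≠ q :=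
    fun h hpq => h (congrArg some hpq)
  match i, j, k, l, hik, hil, hjk, hjl with
  | none, _, none, _, h, _, _, _ => exact absurd rfl h
  | none, _, _, none, _, h, _, _ => exact absurd rfl h
  | _, none, none, _, _, _, h, _ => exact absurd rfl h
  | _, none, _, none, _, _, _, h => exact absurd rfl h
  | some i, some j, some k, some l, hik, hil, hjk, hjl =>
    exact holT_holT (some_ne hik) (some_ne hil) (some_ne hjk) (some_ne hjl)
  | some i, some j, none, none, _, _, _, _ => exact holT_antiDiag_uSS i j
  | some i, some j, none, some l, _, hil, _, hjl =>
    exact holT_antiDiag (some_ne hil) (some_ne hjl)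
  | some i, some j, some k, none, hik, _, hjk, _ =>
    exact holT_antiDiag (some_ne hik) (some_ne hjk)
  | none, none, some k, some l, _, _, _, _ =>
    rw [← lie_skew, neg_eq_zero]
    exact holT_antiDiag_uSS k l
  | none, some j, some k, some l, _, _, hjk, hjl =>
    rw [← lie_skew, neg_eq_zero]
    exact holT_antiDiag (some_ne hjk).symm (some_ne hjl).symm
  | some i, none, some k, some l, hik, hil, _, _ =>
    rw [← lie_skew, neg_eq_zero]
    exact holT_antiDiag (some_ne hik).symm (some_ne hil).symm

theorem holGen_x_t (a : Fin g) {i j k : StrandsStar n} (hik : i ≠ k) (hjk : j ≠ k) :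
    ⁅holGen K g n (.x a k), holGen K g n (.t i j)⁆ = 0 := by
  have some_ne : ∀ {p q : Strands n}, (some p : StrandsStar n) ≠ some q → p ≠ q :=
    fun h hpq => h (congrArg some hpq)
  match i, j, k, hik, hjk with
  | none, _, none, h, _ => exact absurd rfl h
  | _, none, none, _, h => exact absurd rfl h
  | some i, some j, some k, hik, hjk => exact holX_holT a (some_ne hik) (some_ne hjk)
  | some i, some j, none, _, _ =>
    simp only [holGen]
    rw [antiDiag_lie, holT_right, derivT_uX, map_zero, neg_zero]
  | none, none, some k, _, _ =>
    simp only [holGen]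
    rw [lie_antiDiag, holX_right, derivX_uSS, map_zero]
  | none, some j, some k, _, hjk =>
    simp only [holGen]
    rw [lie_antiDiag, holX_right, derivX_tau, if_neg (some_ne hjk).symm, map_zero]
  | some i, none, some k, hik, _ =>
    simp only [holGen]
    rw [lie_antiDiag, holX_right, derivX_tau, if_neg (some_ne hik).symm, map_zero]

theorem holGen_y_t (a : Fin g) {i j k : StrandsStar n} (hik : i ≠ k) (hjk : j ≠ k) :
    ⁅holGen K g n (.y a k), holGen K g n (.t i j)⁆ = 0 := by
  have some_ne : ∀ {p q : Strands n}, (some p : StrandsStar n) ≠ some q → p ≠ q :=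
    fun h hpq => h (congrArg some hpq)
  match i, j, k, hik, hjk with
  | none, _, none, h, _ => exact absurd rfl h
  | _, none, none, _, h => exact absurd rfl h
  | some i, some j, some k, hik, hjk => exact holY_holT a (some_ne hik) (some_ne hjk)
  | some i, some j, none, _, _ =>
    simp only [holGen]
    rw [antiDiag_lie, holT_right, derivT_uY, map_zero, neg_zero]
  | none, none, some k, _, _ =>
    simp only [holGen]
    rw [lie_antiDiag, holY_right, derivY_uSS, map_zero]
  | none, some j, some k, _, hjk =>
    simp only [holGen]
    rw [lie_antiDiag, holY_right, derivY_tau, if_neg (some_ne hjk).symm, map_zero]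
  | some i, none, some k, hik, _ =>
    simp only [holGen]
    rw [lie_antiDiag, holY_right, derivY_tau, if_neg (some_ne hik).symm, map_zero]

/-- Relators on which * does not appear are the relations of `holT`, `holX`, `holY`. Where *
appears, `lie_antiDiag` reduces brackets to values of derivations on 𝔲, or the relator comes from an
identity inside 𝔲. The surface relator at * is `sum_tau`, and at another strand it is `surface_hol`.
-/
theorem lift_holGen_relator (r : FreeLieAlgebra K (Gen g (StrandsStar n)))
    (hr : IsRelator K g (StrandsStar n) r) : FreeLieAlgebra.lift K (holGen K g n) r = 0 := by
  cases hr with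
  | t_symm i j =>
    simp only [map_sub, FreeLieAlgebra.lift_of_apply, sub_eq_zero]
    rcases i with _ | i <;> rcases j with _ | j <;> first | rfl | exact holT_comm i j
  | t_t i j k l hik hil hjk hjl =>
    rw [LieHom.map_lie, FreeLieAlgebra.lift_of_apply, FreeLieAlgebra.lift_of_apply]
    exact holGen_t_t hik hil hjk hjl
  | t_tt i j k hik hjk =>
    simp only [LieHom.map_lie, map_add, FreeLieAlgebra.lift_of_apply]
    rcases i with _ | i <;> rcases j with _ | j <;> rcases k with _ | k <;>
      simp only [ne_eq, Option.some_inj, not_true, reduceCtorEq, not_false_eq_true] at hik hjk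
    · simp only [holGen, ← map_add, ← LieHom.map_lie, uSS_lie, map_zero]
    · simp only [holGen, lie_add, antiDiag_lie (holT K g j k), holT_right, derivT_tau, if_pos,
        if_neg (Ne.symm hjk), add_zero, ← LieHom.map_lie, add_neg_cancel]
    · simp only [holGen, lie_add, antiDiag_lie (holT K g i k), holT_right, derivT_tau, if_pos,
        if_neg (Ne.symm hik), add_zero, ← LieHom.map_lie, neg_add_cancel]
    · simp only [holGen]
      rw [← map_add, lie_antiDiag, holT_right, map_add, derivT_add_tau, map_zero]
    · exact holT_holTT hik hjk
  | x_y a b i j hij =>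
    have h : FreeLieAlgebra.lift K (holGen K g n)
        (if a = b then freeT K g (StrandsStar n) i j else 0)
        = if a = b then holGen K g n (.t i j) else 0 := by
      split_ifs
      · exact FreeLieAlgebra.lift_of_apply ..
      · exact map_zero _
    simp only [map_sub, LieHom.map_lie, FreeLieAlgebra.lift_of_apply, h, sub_eq_zero]
    rcases i with _ | i <;> rcases j with _ | j <;>
      simp only [ne_eq, Option.some_inj, not_true, reduceCtorEq, not_false_eq_true] at hij <;>
      simp only [holGen, lie_antiDiag, antiDiag_lie, holX_right, holY_right, derivX_uY, derivY_uX]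
    · by_cases hab : a = b
      · rw [if_pos hab, if_pos hab.symm, map_neg, neg_neg]
      · rw [if_neg hab, if_neg (Ne.symm hab), map_zero, neg_zero]
    · split_ifs <;> simp
    · exact holX_holY a b hij
  | x_x a b i j hij =>
    simp only [LieHom.map_lie, FreeLieAlgebra.lift_of_apply]
    rcases i with _ | i <;> rcases j with _ | j <;>
      simp only [ne_eq, Option.some_inj, not_true, reduceCtorEq, not_false_eq_true] at hij <;>
      simp only [holGen, lie_antiDiag, antiDiag_lie, holX_right, derivX_uX, map_zero, neg_zero]
    exact holX_holX a b hij
  | y_y a b i j hij =>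
    simp only [LieHom.map_lie, FreeLieAlgebra.lift_of_apply]
    rcases i with _ | i <;> rcases j with _ | j <;>
      simp only [ne_eq, Option.some_inj, not_true, reduceCtorEq, not_false_eq_true] at hij <;>
      simp only [holGen, lie_antiDiag, antiDiag_lie, holY_right, derivY_uY, map_zero, neg_zero]
    exact holY_holY a b hij
  | x_t a k i j hik hjk =>
    rw [LieHom.map_lie, FreeLieAlgebra.lift_of_apply, FreeLieAlgebra.lift_of_apply]
    exact holGen_x_t a hik hjk
  | y_t a k i j hik hjk =>
    rw [LieHom.map_lie, FreeLieAlgebra.lift_of_apply, FreeLieAlgebra.lift_of_apply]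
    exact holGen_y_t a hik hjk
  | xx_t a i j =>
    simp only [LieHom.map_lie, map_add, FreeLieAlgebra.lift_of_apply]
    rcases i with _ | i <;> rcases j with _ | j
    · simp only [holGen, ← map_add, ← LieHom.map_lie, lie_uSS, map_zero]
    · simp only [holGen, add_lie, lie_antiDiag, holX_right, derivX_tau, if_pos, ← map_add,
        antiDiag_right, LieDerivation.ad_apply_apply]
      rw [← lie_skew, neg_add_cancel, map_zero]
    · simp only [holGen, add_lie, lie_antiDiag, holX_right, derivX_tau, if_pos, ← map_add,
        antiDiag_right, LieDerivation.ad_apply_apply]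
      rw [← lie_skew, neg_add_cancel, map_zero]
    · exact holXX_holT a i j
  | yy_t a i j =>
    simp only [LieHom.map_lie, map_add, FreeLieAlgebra.lift_of_apply]
    rcases i with _ | i <;> rcases j with _ | j
    · simp only [holGen, ← map_add, ← LieHom.map_lie, lie_uSS, map_zero]
    · simp only [holGen, add_lie, lie_antiDiag, holY_right, derivY_tau, if_pos, ← map_add,
        antiDiag_right, LieDerivation.ad_apply_apply]
      rw [← lie_skew, neg_add_cancel, map_zero]
    · simp only [holGen, add_lie, lie_antiDiag, holY_right, derivY_tau, if_pos, ← map_add,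
        antiDiag_right, LieDerivation.ad_apply_apply]
      rw [← lie_skew, neg_add_cancel, map_zero]
    · exact holYY_holT a i j
  | surface i =>
    simp only [map_sub, map_add, map_sum, map_smul, LieHom.map_lie,
      FreeLieAlgebra.lift_of_apply, sub_eq_zero]
    rcases i with _ | i
    · rw [sum_erase_none]
      simp only [holGen, ← LieHom.map_lie, ← map_sum, ← map_add, ← map_smul]
      rw [sum_tau, add_sub_cancel]
    · rw [sum_erase_some]
      exact surface_hol i

variable (K g n) in
/-- The homomorphism `𝔱^f_{g,12⋯n*0} → 𝔲^f ⋊ Der(𝔲^f)`. -/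
noncomputable def holMap : FramedLie K g (StrandsStar n) →ₗ⁅K⁆ Hol K g n :=
  liftHom (holGen K g n) lift_holGen_relator

theorem holMap_T (p q : StrandsStar n) : holMap K g n (T K g p q) = holGen K g n (.t p q) :=
  FreeLieAlgebra.lift_of_apply ..

theorem holMap_X (a : Fin g) (p : StrandsStar n) :
    holMap K g n (X K a p) = holGen K g n (.x a p) :=
  FreeLieAlgebra.lift_of_apply ..

theorem holMap_Y (a : Fin g) (p : StrandsStar n) :
    holMap K g n (Y K a p) = holGen K g n (.y a p) :=
  FreeLieAlgebra.lift_of_apply ..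

/-- A Lie subalgebra of `𝔱^f_{g,I}` containing the generators is everything. -/
theorem framed_induction {I : Type} [Fintype I] [DecidableEq I]
    (S : LieSubalgebra K (FramedLie K g I))
    (ht : ∀ i j, T K g i j ∈ S) (hx : ∀ a i, X K a i ∈ S) (hy : ∀ a i, Y K a i ∈ S)
    (z : FramedLie K g I) : z ∈ S := by
  let F : FreeLieAlgebra K (Gen g I) →ₗ⁅K⁆ S := FreeLieAlgebra.lift K fun h =>
    ⟨proj K g I (FreeLieAlgebra.of K h), by
      cases h with
      | t i j => exact ht i j
      | x a i => exact hx a i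
      | y a i => exact hy a i⟩
  have hF : S.incl.comp F = proj K g I := by
    apply FreeLieAlgebra.hom_ext
    intro x
    rw [LieHom.comp_apply, FreeLieAlgebra.lift_of_apply]
    rfl
  obtain ⟨w, rfl⟩ := proj_surjective K g I z
  rw [← hF]
  exact (F w).2

/-- The elements on which two Lie homomorphisms agree. -/
def homEqLocus {L M : Type*} [LieRing L] [LieAlgebra K L] [LieRing M] [LieAlgebra K M]
    (φ ψ : L →ₗ⁅K⁆ M) : LieSubalgebra K L where
  carrier := {w | φ w = ψ w}
  add_mem' {u v} hu hv := by
    change φ (u + v) = ψ (u + v)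
    rw [map_add, map_add, hu, hv]
  zero_mem' := by
    change φ 0 = ψ 0
    rw [map_zero, map_zero]
  smul_mem' c u hu := by
    change φ (c • u) = ψ (c • u)
    rw [map_smul, map_smul, hu]
  lie_mem' {u v} hu hv := by
    change φ ⁅u, v⁆ = ψ ⁅u, v⁆
    rw [LieHom.map_lie, LieHom.map_lie, hu, hv]

/-! ### Injectivity of ι. -/

variable [CharZero K]

theorem iota_uT (k : Fin n) : iota K g n (uT K g n k) = T K g (some (some k)) none := by
  change FreeLieAlgebra.lift K (iotaGen K g n) (FreeLieAlgebra.of K (HBasis.t k)) + (0 : K) • _ = _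
  rw [zero_smul, add_zero, FreeLieAlgebra.lift_of_apply]
  rfl

theorem iota_uX (a : Fin g) : iota K g n (uX K g n a) = X K a none := by
  change FreeLieAlgebra.lift K (iotaGen K g n) (FreeLieAlgebra.of K (HBasis.x a)) + (0 : K) • _ = _
  rw [zero_smul, add_zero, FreeLieAlgebra.lift_of_apply]
  rfl

theorem iota_uY (a : Fin g) : iota K g n (uY K g n a) = Y K a none := by
  change FreeLieAlgebra.lift K (iotaGen K g n) (FreeLieAlgebra.of K (HBasis.y a)) + (0 : K) • _ = _
  rw [zero_smul, add_zero, FreeLieAlgebra.lift_of_apply]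
  rfl

theorem iota_uSS : iota K g n (uSS K g n) = T K g none none := by
  change FreeLieAlgebra.lift K (iotaGen K g n) 0 + (1 : K) • _ = _
  rw [map_zero, zero_add, one_smul]

/-- For i = 0 this is the surface relation at *, solved for t_{*0}. -/
theorem iota_tau (i : Strands n) : iota K g n (tau K g n i) = T K g (some i) none := by
  rcases i with _ | i
  · have h := surface_rel (K := K) (g := g) (none : StrandsStar n)
    rw [sum_erase_none, Fintype.sum_option] at h
    simp only [T_symm (none : StrandsStar n) (some _)] at h
    simp only [tau, omegaStar, map_neg, map_sub, map_add, map_sum, map_smul, LieHom.map_lie,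
      iota_uT, iota_uX, iota_uY, iota_uSS]
    rw [← h]
    abel
  · exact iota_uT i

theorem holMap_iota (w : FibreLie K g n) : holMap K g n (iota K g n w) = antiDiag K g n w := by
  refine fibre_induction (homEqLocus ((holMap K g n).comp (iota K g n)) (antiDiag K g n))
    (fun k => ?_) (fun a => ?_) (fun a => ?_) ?_ w
  · exact (congrArg _ (iota_uT k)).trans (holMap_T _ _)
  · exact (congrArg _ (iota_uX a)).trans (holMap_X _ _)
  · exact (congrArg _ (iota_uY a)).trans (holMap_Y _ _)
  · exact (congrArg _ iota_uSS).trans (holMap_T _ _)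

theorem iota_injective : Function.Injective (iota K g n) := by
  intro u v h
  apply antiDiag_injective
  rw [← holMap_iota, ← holMap_iota, h]

/-! ### The derivation part of `holMap` as bracket with ι(𝔲). -/

/-- The elements `w` on which the action of `z` is the bracket with `z`. -/
noncomputable def actionLocus (z : FramedLie K g (StrandsStar n)) :
    LieSubalgebra K (FibreLie K g n) where
  carrier := {w | iota K g n ((holMap K g n z).right w) = ⁅z, iota K g n w⁆}
  add_mem' {u v} hu hv := by
    simp only [Set.mem_ofPred_eq] at hu hv ⊢
    rw [map_add, map_add, map_add, lie_add, hu, hv]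
  zero_mem' := by
    simp only [Set.mem_ofPred_eq]
    rw [map_zero, map_zero, lie_zero]
  smul_mem' c u hu := by
    simp only [Set.mem_ofPred_eq] at hu ⊢
    rw [map_smul, map_smul, map_smul, lie_smul, hu]
  lie_mem' {u v} hu hv := by
    change iota K g n ((holMap K g n z).right ⁅u, v⁆) = ⁅z, iota K g n ⁅u, v⁆⁆
    change iota K g n ((holMap K g n z).right u) = _ at hu
    change iota K g n ((holMap K g n z).right v) = _ at hv
    rw [LieDerivation.apply_lie_eq_add, map_add, LieHom.map_lie, LieHom.map_lie, LieHom.map_lie,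
      hu, hv, leibniz_lie z, add_comm]

/-- The elements `z` whose action on the fibre is the bracket with `z`. -/
noncomputable def bracketLocus : LieSubalgebra K (FramedLie K g (StrandsStar n)) where
  carrier := {z | ∀ w, iota K g n ((holMap K g n z).right w) = ⁅z, iota K g n w⁆}
  add_mem' {u v} hu hv w := by
    rw [map_add, SemiDirectSum.add_eq_mk, LieDerivation.add_apply, map_add, hu, hv, add_lie]
  zero_mem' w := by
    rw [map_zero, zero_lie]
    exact map_zero _
  smul_mem' c u hu w := by
    rw [map_smul, SemiDirectSum.smul_eq_mk, LieDerivation.smul_apply, map_smul, hu, smul_lie]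
  lie_mem' {u v} hu hv w := by
    rw [LieHom.map_lie, SemiDirectSum.lie_eq_mk, LieDerivation.commutator_apply, map_sub, hu, hv,
      hv, hu, lie_lie]

theorem iota_mem_bracketLocus (v : FibreLie K g n) : iota K g n v ∈ bracketLocus := by
  intro w
  rw [holMap_iota, ← LieHom.map_lie]
  simp [-Prod.bracket_apply]

theorem iota_derivT_tau (i j k : Strands n) : iota K g n (derivT K g n i j (tau K g n k))
    = ⁅T K g (some i : StrandsStar n) (some j), T K g (some k) none⁆ := by
  -- This is the relation [t_{k*}, t_{kl} + t_{*l}] = 0.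
  have key : ∀ {l : Strands n}, l ≠ k →
      ⁅T K g (some k : StrandsStar n) none, T K g (some l) none⁆
        = ⁅T K g (some k : StrandsStar n) (some l), T K g (some k) none⁆ := by
    intro l hl
    have h := T_TT (K := K) (g := g) (i := (some k : StrandsStar n)) (j := none) (k := some l)
      (fun h => hl (Option.some_inj.1 h).symm) (by simp)
    rw [lie_add, T_symm none, ← lie_skew (T K g (some k) none) (T K g (some k) (some l))] at h
    exact eq_of_sub_eq_zero (by rw [← h]; abel)
  by_cases hi : i = k
  · subst hi
    by_cases hj : j = i
    · subst hj
      rw [derivT_self, ← lie_skew, T_self_central, neg_zero]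
      exact map_zero _
    · rw [derivT_tau, if_pos rfl, if_neg hj, add_zero, LieHom.map_lie, iota_tau, iota_tau, key hj]
  · by_cases hj : j = k
    · subst hj
      rw [derivT_tau, if_pos rfl, if_neg hi, zero_add, LieHom.map_lie, iota_tau, iota_tau, key hi,
        T_symm (some i)]
    · rw [derivT_tau, if_neg hi, if_neg hj, add_zero, map_zero, T_T] <;> simp [hi, hj]

theorem iota_derivX_tau (a : Fin g) (i k : Strands n) :
    iota K g n (derivX K n a i (tau K g n k))
      = ⁅X K a (some i : StrandsStar n), T K g (some k) none⁆ := by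
  rw [derivX_tau]
  split_ifs with h
  · subst h
    have h := XX_T (K := K) a (some i : StrandsStar n) none
    rw [add_lie, ← lie_skew (X K a none)] at h
    rw [LieHom.map_lie, iota_tau, iota_uX]
    exact (eq_of_sub_eq_zero (by rw [← h]; abel)).symm
  · rw [map_zero, X_T] <;> simp [Ne.symm h]

theorem iota_derivY_tau (a : Fin g) (i k : Strands n) :
    iota K g n (derivY K n a i (tau K g n k))
      = ⁅Y K a (some i : StrandsStar n), T K g (some k) none⁆ := by
  rw [derivY_tau]
  split_ifs with h
  · subst h
    have h := YY_T (K := K) a (some i : StrandsStar n) none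
    rw [add_lie, ← lie_skew (Y K a none)] at h
    rw [LieHom.map_lie, iota_tau, iota_uY]
    exact (eq_of_sub_eq_zero (by rw [← h]; abel)).symm
  · rw [map_zero, Y_T] <;> simp [Ne.symm h]

/-- Makes ι(𝔲) an ideal with known brackets. The admissible z form a subalgebra, as do the
admissible w for fixed z, so generators suffice. A generator z carrying * lies in ι(𝔲) and acts by
ad; for the others the bracket is one of the defining relations. -/
theorem iota_action (z : FramedLie K g (StrandsStar n)) (w : FibreLie K g n) :
    iota K g n ((holMap K g n z).right w) = ⁅z, iota K g n w⁆ := by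
  refine framed_induction bracketLocus (fun p q => ?_) (fun a p => ?_) (fun a p => ?_) z w
  · rcases p with _ | i <;> rcases q with _ | j
    · exact iota_uSS (K := K) (g := g) (n := n) ▸ iota_mem_bracketLocus _
    · rw [T_symm]
      exact iota_tau (K := K) (g := g) j ▸ iota_mem_bracketLocus _
    · exact iota_tau (K := K) (g := g) i ▸ iota_mem_bracketLocus _
    · refine fibre_induction (actionLocus _) (fun k => ?_) (fun b => ?_) (fun b => ?_) ?_ <;>
        refine (congrArg (fun u : Hol K g n => iota K g n (u.right _)) (holMap_T _ _)).trans ?_ <;>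
        simp only [holGen, holT_right]
      · rw [iota_uT]
        exact iota_derivT_tau i j (some k)
      · rw [derivT_uX, map_zero, iota_uX, ← lie_skew, X_T, neg_zero] <;> simp
      · rw [derivT_uY, map_zero, iota_uY, ← lie_skew, Y_T, neg_zero] <;> simp
      · rw [derivT_uSS, map_zero, iota_uSS, T_self_central]
  · rcases p with _ | i
    · exact iota_uX (K := K) (n := n) a ▸ iota_mem_bracketLocus _
    · refine fibre_induction (actionLocus _) (fun k => ?_) (fun b => ?_) (fun b => ?_) ?_ <;>
        refine (congrArg (fun u : Hol K g n => iota K g n (u.right _)) (holMap_X _ _)).trans ?_ <;>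
        simp only [holGen, holX_right]
      · rw [iota_uT]
        exact iota_derivX_tau a i (some k)
      · rw [derivX_uX, map_zero, iota_uX, X_X]
        simp
      · rw [derivX_uY, iota_uY, X_Y _ _ (by simp)]
        split_ifs
        · exact iota_tau i
        · exact map_zero _
      · rw [derivX_uSS, map_zero, iota_uSS, T_self_central]
  · rcases p with _ | i
    · exact iota_uY (K := K) (n := n) a ▸ iota_mem_bracketLocus _
    · refine fibre_induction (actionLocus _) (fun k => ?_) (fun b => ?_) (fun b => ?_) ?_ <;>
        refine (congrArg (fun u : Hol K g n => iota K g n (u.right _)) (holMap_Y _ _)).trans ?_ <;>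
        simp only [holGen, holY_right]
      · rw [iota_uT]
        exact iota_derivY_tau a i (some k)
      · rw [derivY_uX, iota_uX, ← lie_skew, X_Y _ _ (by simp)]
        by_cases h : a = b
        · rw [if_pos h, if_pos h.symm, map_neg, iota_tau, T_symm]
        · rw [if_neg h, if_neg (Ne.symm h), map_zero, neg_zero]
      · rw [derivY_uY, map_zero, iota_uY, Y_Y]
        simp
      · rw [derivY_uSS, map_zero, iota_uSS, T_self_central]

end HolMap

/-! ### The semidirect sum decomposition -/

section Splitting

open LieAlgebra

variable {K : Type*} [Field K] {g n : ℕ}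

theorem ad_apply_fibre (v w : FibreLie K g n) : LieDerivation.ad K _ v w = ⁅v, w⁆ := by
  simp [-Prod.bracket_apply]

theorem derivT_uT (i j : Strands n) (k : Fin n) : derivT K g n i j (uT K g n k)
    = (if i = some k then ⁅uT K g n k, tau K g n j⁆ else 0)
      + if j = some k then ⁅uT K g n k, tau K g n i⁆ else 0 := deriv_uT _ _

theorem derivX_uT (a : Fin g) (i : Strands n) (k : Fin n) : derivX K n a i (uT K g n k)
    = if i = some k then ⁅uT K g n k, uX K g n a⁆ else 0 := deriv_uT _ _

theorem derivY_uT (a : Fin g) (i : Strands n) (k : Fin n) : derivY K n a i (uT K g n k)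
    = if i = some k then ⁅uT K g n k, uY K g n a⁆ else 0 := deriv_uT _ _

theorem lie_ite {L : Type*} [LieRing L] (p : Prop) [Decidable p] (u v : L) :
    ⁅u, if p then v else 0⁆ = if p then ⁅u, v⁆ else 0 := by
  split_ifs <;> simp

variable [CharZero K]

/-! ### Values of ε^* and ∘_0 id_{*0} on generators. -/

theorem substitute_T {I J : Type} [Fintype I] [DecidableEq I] [Fintype J] [DecidableEq J]
    (f : J → I) (i j : I) :
    substitute K g f (T K g i j) = ∑ p ∈ fib f i, ∑ q ∈ fib f j, T K g p q :=
  FreeLieAlgebra.lift_of_apply ..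

theorem substitute_X {I J : Type} [Fintype I] [DecidableEq I] [Fintype J] [DecidableEq J]
    (f : J → I) (a : Fin g) (i : I) : substitute K g f (X K a i) = ∑ p ∈ fib f i, X K a p :=
  FreeLieAlgebra.lift_of_apply ..

theorem substitute_Y {I J : Type} [Fintype I] [DecidableEq I] [Fintype J] [DecidableEq J]
    (f : J → I) (a : Fin g) (i : I) : substitute K g f (Y K a i) = ∑ p ∈ fib f i, Y K a p :=
  FreeLieAlgebra.lift_of_apply ..

theorem fib_inclusion_none : fib (inclusion n) none = ∅ := by
  ext p
  simp [fib, inclusion]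

theorem fib_inclusion_some (i : Strands n) : fib (inclusion n) (some i) = {i} := by
  ext p
  simp [fib, inclusion]

theorem fib_collapse_some (i : Fin n) : fib (collapse n) (some i) = {some (some i)} := by
  ext p
  rw [fib, Finset.mem_filter]
  rcases p with _ | _ | p <;> simp [collapse]

theorem fib_collapse_none : fib (collapse n) none = {none, some none} := by
  ext p
  rw [fib, Finset.mem_filter]
  rcases p with _ | _ | p <;> simp [collapse]

theorem sum_fib_collapse_none {M : Type*} [AddCommGroup M] (f : StrandsStar n → M) :
    ∑ p ∈ fib (collapse n) none, f p = f none + f (some none) := by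
  rw [fib_collapse_none, Finset.sum_pair (by simp)]

theorem sum_fib_collapse_some {M : Type*} [AddCommGroup M] (f : StrandsStar n → M) (i : Fin n) :
    ∑ p ∈ fib (collapse n) (some i), f p = f (some (some i)) := by
  rw [fib_collapse_some, Finset.sum_singleton]

theorem epsStar_T_some (i j : Strands n) :
    epsStar K g n (T K g (some i) (some j)) = T K g i j := by
  rw [epsStar, substitute_T, fib_inclusion_some, fib_inclusion_some, Finset.sum_singleton,
    Finset.sum_singleton]

theorem epsStar_T_none (p : StrandsStar n) : epsStar K g n (T K g p none) = 0 := by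
  rw [epsStar, substitute_T, fib_inclusion_none]
  simp

theorem epsStar_X_some (a : Fin g) (i : Strands n) : epsStar K g n (X K a (some i)) = X K a i := by
  rw [epsStar, substitute_X, fib_inclusion_some, Finset.sum_singleton]

theorem epsStar_X_none (a : Fin g) : epsStar K g n (X K a none) = 0 := by
  rw [epsStar, substitute_X, fib_inclusion_none, Finset.sum_empty]

theorem epsStar_Y_some (a : Fin g) (i : Strands n) : epsStar K g n (Y K a (some i)) = Y K a i := by
  rw [epsStar, substitute_Y, fib_inclusion_some, Finset.sum_singleton]

theorem epsStar_Y_none (a : Fin g) : epsStar K g n (Y K a none) = 0 := by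
  rw [epsStar, substitute_Y, fib_inclusion_none, Finset.sum_empty]

theorem doubleZero_T_some_some (i j : Fin n) : doubleZero K g n (T K g (some i) (some j))
    = T K g (some (some i)) (some (some j)) := by
  rw [doubleZero, substitute_T]
  simp only [sum_fib_collapse_some]

theorem doubleZero_T_some_none (i : Fin n) : doubleZero K g n (T K g (some i) none)
    = T K g (some (some i)) none + T K g (some (some i)) (some none) := by
  rw [doubleZero, substitute_T]
  simp only [sum_fib_collapse_some, sum_fib_collapse_none]

theorem doubleZero_T_none_none : doubleZero K g n (T K g none none)
    = T K g none none + (2 : K) • T K g none (some none) + T K g (some none) (some none) := by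
  rw [doubleZero, substitute_T]
  simp only [sum_fib_collapse_none]
  rw [T_symm (some none) none, two_smul]
  abel

theorem doubleZero_X_some (a : Fin g) (i : Fin n) :
    doubleZero K g n (X K a (some i)) = X K a (some (some i)) := by
  rw [doubleZero, substitute_X, sum_fib_collapse_some]

theorem doubleZero_X_none (a : Fin g) :
    doubleZero K g n (X K a none) = X K a none + X K a (some none) := by
  rw [doubleZero, substitute_X, sum_fib_collapse_none]

theorem doubleZero_Y_some (a : Fin g) (i : Fin n) :
    doubleZero K g n (Y K a (some i)) = Y K a (some (some i)) := by
  rw [doubleZero, substitute_Y, sum_fib_collapse_some]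

theorem doubleZero_Y_none (a : Fin g) :
    doubleZero K g n (Y K a none) = Y K a none + Y K a (some none) := by
  rw [doubleZero, substitute_Y, sum_fib_collapse_none]

theorem epsStar_comp_doubleZero : (epsStar K g n).comp (doubleZero K g n) = LieHom.id := by
  refine hom_ext (fun i j => ?_) (fun a i => ?_) (fun a i => ?_) <;> rw [LieHom.comp_apply]
  · rcases i with _ | i <;> rcases j with _ | j
    · rw [doubleZero_T_none_none, T_symm none (some none)]
      simp only [map_add, map_smul, epsStar_T_none, epsStar_T_some, smul_zero, zero_add]
      rfl
    · rw [T_symm, doubleZero_T_some_none]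
      simp only [map_add, epsStar_T_none, epsStar_T_some, zero_add]
      rfl
    · rw [doubleZero_T_some_none]
      simp only [map_add, epsStar_T_none, epsStar_T_some, zero_add]
      rfl
    · rw [doubleZero_T_some_some, epsStar_T_some]
      rfl
  · rcases i with _ | i
    · rw [doubleZero_X_none, map_add, epsStar_X_none, epsStar_X_some, zero_add]
      rfl
    · rw [doubleZero_X_some, epsStar_X_some]
      rfl
  · rcases i with _ | i
    · rw [doubleZero_Y_none, map_add, epsStar_Y_none, epsStar_Y_some, zero_add]
      rfl
    · rw [doubleZero_Y_some, epsStar_Y_some]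
      rfl

theorem epsStar_iota (w : FibreLie K g n) : epsStar K g n (iota K g n w) = 0 := by
  refine fibre_induction (homEqLocus ((epsStar K g n).comp (iota K g n)) 0)
    (fun k => ?_) (fun a => ?_) (fun a => ?_) ?_ w
  · exact (congrArg _ (iota_uT k)).trans (epsStar_T_none _)
  · exact (congrArg _ (iota_uX a)).trans (epsStar_X_none _)
  · exact (congrArg _ (iota_uY a)).trans (epsStar_Y_none _)
  · exact (congrArg _ iota_uSS).trans (epsStar_T_none _)

/-! ### The action and its table of values. -/

variable (K g n) in
/-- The action of `𝔱^f_{g,12⋯n0}` on `𝔲^f_{g,12⋯n}`. -/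
noncomputable def action : FramedLie K g (Strands n) →ₗ⁅K⁆ Der K g n :=
  (SemiDirectSum.projr LieHom.id).comp ((holMap K g n).comp (doubleZero K g n))

theorem action_apply (z : FramedLie K g (Strands n)) (w : FibreLie K g n) :
    action K g n z w = (holMap K g n (doubleZero K g n z)).right w := rfl

/-- This is what F needs in order to respect mixed brackets. Since the action is a pullback along
`doubleZero`, no relator has to be checked again for it. -/
theorem iota_action_apply (z : FramedLie K g (Strands n)) (w : FibreLie K g n) :
    iota K g n (action K g n z w) = ⁅doubleZero K g n z, iota K g n w⁆ :=
  iota_action _ w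

theorem action_T_some_some (i j : Fin n) :
    action K g n (T K g (some i) (some j)) = derivT K g n (some i) (some j) := by
  refine LieDerivation.ext fun w => ?_
  rw [action_apply, doubleZero_T_some_some, holMap_T]
  rfl

theorem action_T_some_none (i : Fin n) : action K g n (T K g (some i) none)
    = LieDerivation.ad K _ (uT K g n i) + derivT K g n (some i) none := by
  refine LieDerivation.ext fun w => ?_
  rw [action_apply, doubleZero_T_some_none, map_add, holMap_T, holMap_T]
  rfl

/-- Of the terms t_{**} + 2 t_{*0} + t_{00}, the outer two act by zero, leaving twice ad τ_0. -/
theorem action_T_none_none : action K g n (T K g none none)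
    = (2 : K) • LieDerivation.ad K _ (tau K g n none) := by
  refine LieDerivation.ext fun w => ?_
  rw [action_apply, doubleZero_T_none_none, map_add, map_add, map_smul, holMap_T, holMap_T,
    holMap_T]
  change (LieDerivation.ad K _ (uSS K g n) + (2 : K) • LieDerivation.ad K _ (tau K g n none)
    + derivT K g n none none) w = _
  rw [derivT_self, add_zero, LieDerivation.add_apply, ad_apply_fibre, uSS_lie, zero_add]

theorem action_X_some (a : Fin g) (i : Fin n) :
    action K g n (X K a (some i)) = derivX K n a (some i) := by
  refine LieDerivation.ext fun w => ?_
  rw [action_apply, doubleZero_X_some, holMap_X]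
  rfl

theorem action_X_none (a : Fin g) : action K g n (X K a none)
    = LieDerivation.ad K _ (uX K g n a) + derivX K n a none := by
  refine LieDerivation.ext fun w => ?_
  rw [action_apply, doubleZero_X_none, map_add, holMap_X, holMap_X]
  rfl

theorem action_Y_some (a : Fin g) (i : Fin n) :
    action K g n (Y K a (some i)) = derivY K n a (some i) := by
  refine LieDerivation.ext fun w => ?_
  rw [action_apply, doubleZero_Y_some, holMap_Y]
  rfl

theorem action_Y_none (a : Fin g) : action K g n (Y K a none)
    = LieDerivation.ad K _ (uY K g n a) + derivY K n a none := by
  refine LieDerivation.ext fun w => ?_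
  rw [action_apply, doubleZero_Y_none, map_add, holMap_Y, holMap_Y]
  rfl

theorem isTableAction_action : IsTableAction (action K g n) where
  tij_t i j k := by
    rw [action_T_some_some, derivT_uT, lie_add, lie_ite, lie_ite]
    simp only [Option.some_inj]
    rfl
  tij_x i j b := by rw [action_T_some_some, derivT_uX]
  tij_y i j b := by rw [action_T_some_some, derivT_uY]
  tij_s i j := by rw [action_T_some_some, derivT_uSS]
  ti0_t i k := by
    rw [action_T_some_none, LieDerivation.add_apply, ad_apply_fibre, derivT_uT, add_lie]
    by_cases h : i = k
    · subst h
      rw [if_pos rfl, if_pos rfl, if_neg (by simp), add_zero, omegaStar_eq_neg_tau, neg_lie,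
        lie_skew]
    · rw [if_neg (by simpa using h), if_neg (by simp), if_neg h, zero_lie, add_zero]
  ti0_x i b := by
    rw [action_T_some_none, LieDerivation.add_apply, ad_apply_fibre, derivT_uX, add_zero]
  ti0_y i b := by
    rw [action_T_some_none, LieDerivation.add_apply, ad_apply_fibre, derivT_uY, add_zero]
  ti0_s i := by
    rw [action_T_some_none, LieDerivation.add_apply, ad_apply_fibre, derivT_uSS, add_zero, lie_uSS]
  t00_t k := by
    rw [action_T_none_none, LieDerivation.smul_apply, ad_apply_fibre, omegaStar_eq_neg_tau, lie_neg,
      lie_skew]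
  t00_x b := by
    rw [action_T_none_none, LieDerivation.smul_apply, ad_apply_fibre, omegaStar_eq_neg_tau, lie_neg,
      lie_skew]
  t00_y b := by
    rw [action_T_none_none, LieDerivation.smul_apply, ad_apply_fibre, omegaStar_eq_neg_tau, lie_neg,
      lie_skew]
  t00_s := by
    rw [action_T_none_none, LieDerivation.smul_apply, ad_apply_fibre, lie_uSS, smul_zero]
  xi_t i k a := by
    rw [action_X_some, derivX_uT]
    simp only [Option.some_inj]
  xi_x i a b := by rw [action_X_some, derivX_uX]
  xi_y i a b := by
    rw [action_X_some, derivX_uY]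
    rfl
  xi_s i a := by rw [action_X_some, derivX_uSS]
  x0_t k a := by
    rw [action_X_none, LieDerivation.add_apply, ad_apply_fibre, derivX_uT, if_neg (by simp),
      add_zero]
  x0_x a b := by
    rw [action_X_none, LieDerivation.add_apply, ad_apply_fibre, derivX_uX, add_zero]
  x0_y a b := by
    rw [action_X_none, LieDerivation.add_apply, ad_apply_fibre, derivX_uY, omegaStar_eq_neg_tau]
    split_ifs <;> simp
  x0_s a := by
    rw [action_X_none, LieDerivation.add_apply, ad_apply_fibre, derivX_uSS, lie_uSS, add_zero]
  yi_t i k a := by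
    rw [action_Y_some, derivY_uT]
    simp only [Option.some_inj]
  yi_x i a b := by
    rw [action_Y_some, derivY_uX]
    rfl
  yi_y i a b := by rw [action_Y_some, derivY_uY]
  yi_s i a := by rw [action_Y_some, derivY_uSS]
  y0_t k a := by
    rw [action_Y_none, LieDerivation.add_apply, ad_apply_fibre, derivY_uT, if_neg (by simp),
      add_zero]
  y0_x a b := by
    rw [action_Y_none, LieDerivation.add_apply, ad_apply_fibre, derivY_uX, omegaStar_eq_neg_tau]
  y0_y a b := by
    rw [action_Y_none, LieDerivation.add_apply, ad_apply_fibre, derivY_uY, add_zero]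
  y0_s a := by
    rw [action_Y_none, LieDerivation.add_apply, ad_apply_fibre, derivY_uSS, lie_uSS, add_zero]

/-! ### The isomorphism F and its inverse G. -/

variable (K g n) in
/-- The homomorphism `F = ι + ∘_0 id_{*0}` from the semidirect sum. -/
noncomputable def mapF : SemiDirectSum (FibreLie K g n) (FramedLie K g (Strands n)) (action K g n)
    →ₗ⁅K⁆ FramedLie K g (StrandsStar n) where
  toFun w := iota K g n w.left + doubleZero K g n w.right
  map_add' u v := by
    rw [SemiDirectSum.add_eq_mk, map_add, map_add]
    abel
  map_smul' c u := by
    rw [SemiDirectSum.smul_eq_mk, map_smul, map_smul, RingHom.id_apply, smul_add]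
  map_lie' {u v} := by
    rw [SemiDirectSum.lie_eq_mk, map_sub, map_add, iota_action_apply, iota_action_apply,
      LieHom.map_lie, LieHom.map_lie, add_lie, lie_add, lie_add,
      ← lie_skew (iota K g n u.left) (doubleZero K g n v.right)]
    abel

theorem mapF_apply
    (w : SemiDirectSum (FibreLie K g n) (FramedLie K g (Strands n)) (action K g n)) :
    mapF K g n w = iota K g n w.left + doubleZero K g n w.right := rfl

theorem epsStar_mapF
    (w : SemiDirectSum (FibreLie K g n) (FramedLie K g (Strands n)) (action K g n)) :
    epsStar K g n (mapF K g n w) = w.right := by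
  rw [mapF_apply, map_add, epsStar_iota, zero_add, ← LieHom.comp_apply, epsStar_comp_doubleZero]
  rfl

theorem mapF_injective : Function.Injective (mapF K g n) := by
  intro u v h
  have hr : u.right = v.right := by rw [← epsStar_mapF, ← epsStar_mapF, h]
  refine SemiDirectSum.ext (iota_injective ?_) hr
  rw [mapF_apply, mapF_apply, hr] at h
  exact add_right_cancel h

theorem mapF_inl (w : FibreLie K g n) : mapF K g n ⟨w, 0⟩ = iota K g n w := by
  rw [mapF_apply, map_zero, add_zero]

theorem mapF_T_some_some (i j : Fin n) : mapF K g n ⟨0, T K g (some i) (some j)⟩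
    = T K g (some (some i)) (some (some j)) := by
  rw [mapF_apply, map_zero, zero_add, doubleZero_T_some_some]

theorem mapF_T_some_zero (i : Fin n) : mapF K g n ⟨-uT K g n i, T K g (some i) none⟩
    = T K g (some (some i)) (some none) := by
  rw [mapF_apply, map_neg, doubleZero_T_some_none, iota_uT, neg_add_cancel_left]

theorem iota_omegaStar : iota K g n (omegaStar K g n) = -T K g none (some none) := by
  rw [omegaStar_eq_neg_tau, map_neg, iota_tau, T_symm]

theorem mapF_T_zero_zero :
    mapF K g n ⟨-uSS K g n + (2 : K) • omegaStar K g n, T K g none none⟩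
      = T K g (some none) (some none) := by
  rw [mapF_apply, map_add, map_neg, map_smul, doubleZero_T_none_none, iota_uSS, iota_omegaStar,
    smul_neg]
  abel

theorem mapF_X_some (a : Fin g) (i : Fin n) :
    mapF K g n ⟨0, X K a (some i)⟩ = X K a (some (some i)) := by
  rw [mapF_apply, map_zero, zero_add, doubleZero_X_some]

theorem mapF_X_zero (a : Fin g) : mapF K g n ⟨-uX K g n a, X K a none⟩ = X K a (some none) := by
  rw [mapF_apply, map_neg, doubleZero_X_none, iota_uX, neg_add_cancel_left]

theorem mapF_Y_some (a : Fin g) (i : Fin n) :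
    mapF K g n ⟨0, Y K a (some i)⟩ = Y K a (some (some i)) := by
  rw [mapF_apply, map_zero, zero_add, doubleZero_Y_some]

theorem mapF_Y_zero (a : Fin g) : mapF K g n ⟨-uY K g n a, Y K a none⟩ = Y K a (some none) := by
  rw [mapF_apply, map_neg, doubleZero_Y_none, iota_uY, neg_add_cancel_left]

theorem mapF_surjective : Function.Surjective (mapF K g n) := by
  -- The strand 0 is included: t_{0*} is reached from τ_0 = -ω_*.
  have hstar : ∀ i : Strands n, ∃ w, mapF K g n w = T K g (some i) none :=
    fun i => ⟨⟨tau K g n i, 0⟩, (mapF_inl _).trans (iota_tau i)⟩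
  intro z
  refine (LieHom.mem_range _ _).1
    (framed_induction (mapF K g n).range (fun p q => ?_) (fun a p => ?_) (fun a p => ?_) z) <;>
    rw [LieHom.mem_range]
  · rcases p with _ | i <;> rcases q with _ | j
    · exact ⟨_, (mapF_inl _).trans iota_uSS⟩
    · rw [T_symm]
      exact hstar j
    · exact hstar i
    · rcases i with _ | i <;> rcases j with _ | j
      · exact ⟨_, mapF_T_zero_zero⟩
      · rw [T_symm]
        exact ⟨_, mapF_T_some_zero j⟩
      · exact ⟨_, mapF_T_some_zero i⟩
      · exact ⟨_, mapF_T_some_some i j⟩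
  · rcases p with _ | _ | i
    · exact ⟨_, (mapF_inl _).trans (iota_uX a)⟩
    · exact ⟨_, mapF_X_zero a⟩
    · exact ⟨_, mapF_X_some a i⟩
  · rcases p with _ | _ | i
    · exact ⟨_, (mapF_inl _).trans (iota_uY a)⟩
    · exact ⟨_, mapF_Y_zero a⟩
    · exact ⟨_, mapF_Y_some a i⟩

variable (K g n) in
/-- The isomorphism of the semidirect sum with `𝔱^f_{g,12⋯n*0}`. -/
noncomputable def equivF :
    SemiDirectSum (FibreLie K g n) (FramedLie K g (Strands n)) (action K g n)
      ≃ₗ⁅K⁆ FramedLie K g (StrandsStar n) :=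
  LieEquiv.ofBijective (mapF K g n) ⟨mapF_injective, mapF_surjective⟩

variable (K g n) in
/-- The inverse `G` of `F`. -/
noncomputable def mapG : FramedLie K g (StrandsStar n) →ₗ⁅K⁆
    SemiDirectSum (FibreLie K g n) (FramedLie K g (Strands n)) (action K g n) :=
  (equivF K g n).symm

theorem mapF_mapG (z : FramedLie K g (StrandsStar n)) : mapF K g n (mapG K g n z) = z :=
  (equivF K g n).apply_symm_apply z

/-- Each entry of the table of G becomes a computation of F, so G need not be constructed from
generators and relators. -/
theorem mapG_eq {z : FramedLie K g (StrandsStar n)}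
    {w : SemiDirectSum (FibreLie K g n) (FramedLie K g (Strands n)) (action K g n)}
    (h : mapF K g n w = z) : mapG K g n z = w :=
  mapF_injective ((mapF_mapG z).trans h.symm)

theorem isTableG_mapG : IsTableG (mapG K g n) where
  tij i j := mapG_eq (mapF_T_some_some i j)
  tis i := mapG_eq ((mapF_inl _).trans (iota_uT i))
  ti0 i := mapG_eq (mapF_T_some_zero i)
  tss := mapG_eq ((mapF_inl _).trans iota_uSS)
  ts0 := mapG_eq ((mapF_inl _).trans (by rw [map_neg, iota_omegaStar, neg_neg]))
  t00 := mapG_eq mapF_T_zero_zero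
  xi a i := mapG_eq (mapF_X_some a i)
  xs a := mapG_eq ((mapF_inl _).trans (iota_uX a))
  x0 a := mapG_eq (mapF_X_zero a)
  yi a i := mapG_eq (mapF_Y_some a i)
  ys a := mapG_eq ((mapF_inl _).trans (iota_uY a))
  y0 a := mapG_eq (mapF_Y_zero a)

theorem isExtension_iota_epsStar : IsExtension (iota K g n) (epsStar K g n) where
  ker_eq_bot := (LieHom.ker_eq_bot _).2 iota_injective
  range_eq_top := (LieHom.range_eq_top _).2 fun z =>
    ⟨doubleZero K g n z, LieHom.congr_fun epsStar_comp_doubleZero z⟩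
  exact := by
    rw [LieHom.range_eq_ker_iff]
    intro z
    constructor
    · intro hz
      -- With z = F(w), the image ε^*(z) is the second component of w. If it vanishes, z is ι of the
      -- first component.
      obtain ⟨w, rfl⟩ := mapF_surjective z
      rw [epsStar_mapF] at hz
      exact ⟨w.left, by rw [mapF_apply, hz, map_zero, add_zero]⟩
    · rintro ⟨w, rfl⟩
      exact epsStar_iota w

end Splitting

end SurfaceBraid

theorem theorem8 (K : Type*) [Field K] [CharZero K] (g n : ℕ) :
    (LieAlgebra.IsExtension (SurfaceBraid.iota K g n) (SurfaceBraid.epsStar K g n) ∧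
      (SurfaceBraid.epsStar K g n).comp (SurfaceBraid.doubleZero K g n) = LieHom.id) ∧
    ∃ ρ : SurfaceBraid.FramedLie K g (SurfaceBraid.Strands n) →ₗ⁅K⁆
        LieDerivation K (SurfaceBraid.FibreLie K g n) (SurfaceBraid.FibreLie K g n),
      SurfaceBraid.IsTableAction ρ ∧
      ∃ (F : LieAlgebra.SemiDirectSum (SurfaceBraid.FibreLie K g n)
            (SurfaceBraid.FramedLie K g (SurfaceBraid.Strands n)) ρ →ₗ⁅K⁆
            SurfaceBraid.FramedLie K g (SurfaceBraid.StrandsStar n))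
        (G : SurfaceBraid.FramedLie K g (SurfaceBraid.StrandsStar n) →ₗ⁅K⁆
            LieAlgebra.SemiDirectSum (SurfaceBraid.FibreLie K g n)
              (SurfaceBraid.FramedLie K g (SurfaceBraid.Strands n)) ρ),
        (∀ w, F w = SurfaceBraid.iota K g n w.left + SurfaceBraid.doubleZero K g n w.right) ∧
        SurfaceBraid.IsTableG G ∧
        F.comp G = LieHom.id ∧ G.comp F = LieHom.id ∧
        (LieAlgebra.SemiDirectSum.projr ρ).comp G = SurfaceBraid.epsStar K g n := by
  refine ⟨⟨SurfaceBraid.isExtension_iota_epsStar, SurfaceBraid.epsStar_comp_doubleZero⟩,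
    SurfaceBraid.action K g n, SurfaceBraid.isTableAction_action, SurfaceBraid.mapF K g n,
    SurfaceBraid.mapG K g n, SurfaceBraid.mapF_apply, SurfaceBraid.isTableG_mapG, ?_, ?_, ?_⟩
  · exact LieHom.ext SurfaceBraid.mapF_mapG
  · exact LieHom.ext fun w => SurfaceBraid.mapG_eq rfl
  · refine LieHom.ext fun z => ?_
    obtain ⟨w, rfl⟩ := SurfaceBraid.mapF_surjective z
    rw [LieHom.comp_apply, SurfaceBraid.mapG_eq rfl, SurfaceBraid.epsStar_mapF]
    rfl
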